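/- **Setting.** Fix a one-parameter generalized linear model: a $\sigma$-finite measure $\nu_y$ on $\mathbb R$ and functions $a,b,c:\mathbb R\to\mathbb R$ with $a,b$ continuously differentiable, $a'$ nowhere zero, $c$ measurable, such that $f(y,h)=\exp\{a(h)y+b(h)+c(y)\}$ satisfies $\int f(y,h)\,\nu_y(dy)=1$ for every $h\in\mathbb R$. Put $\psi=-b'/a'$ (the mean function) and $D(R)=1+R\,\sup_{|h|\le R}|a'(h)|\,\sup_{|h|\le R}|\psi(h)|$. For each $n$ let $K_n\in\mathbb N$ (nondecreasing in $n$), let $\nu_x=\nu_{x,n}$ be a probability measure on $\mathbb R^{K_n}$ under which $|x_j|\le 1$ for all $j$ almost surely, and let $\beta^*=\beta^{*(n)}\in\mathbb R^{K_n}$ (for example the first $K_n$ terms of one fixed sequence) be such that $\lim_{n\to\infty}\sum_{j=1}^{K_n}|\beta^*_j|$ exists and is finite. The data $D^n=(x^{(i)},y^{(i)})_{i=1}^n$ are i.i.d. with density $p^*(y,x)=f(y,x^T\beta^*)$ with respect to $\nu_x(dx)\nu_y(dy)$; $P^*$ and $E^*_{D^n}$ are the corresponding probability and expectation. **Prior.**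 Let $r_n,\bar r_n$ be integers with $1\le r_n\le\bar r_n<K_n$. A model is a set $\gamma\subseteq\{1,\dots,K_n\}$, with prior probability proportional to $\lambda_n^{|\gamma|}(1-\lambda_n)^{K_n-|\gamma|}\,1[|\gamma|\le\bar r_n]$, $\lambda_n=r_n/K_n$. Given $\gamma$, $\beta_\gamma\sim N(0,V_\gamma)$, where $V_\gamma$ (which may depend on $n$) is a positive definite $|\gamma|\times|\gamma|$ matrix for $|\gamma|\le\bar r_n$. Write $p(y,x|\gamma,\beta_\gamma)=f(y,x_\gamma^T\beta_\gamma)$, and let $\pi(\cdot|D^n)$ be the posterior on $(\gamma,\beta_\gamma)$, that is, the prior weighted by $\prod_{i=1}^n p(y^{(i)},x^{(i)}|\gamma,\beta_\gamma)$ and normalized. Let $d(p,p^*)^2=\iint|p(y,x|\gamma,\beta_\gamma)^{1/2}-p^*(y,x)^{1/2}|^2\,\nu_y(dy)\nu_x(dx)$. **Notation.** $\mathrm{ch}_1$ is the largest eigenvalue; $\Delta(r)=\inf_{|\gamma|=r}\sum_{j\notin\gamma}|\beta^*_j|$, $B(r)=\sup_{|\gamma|=r}\mathrm{ch}_1(V_\gamma^{-1})$,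 $\bar B(r)=\sup_{|\gamma|=r}\mathrm{ch}_1(V_\gamma)$, $\tilde B_n=\sup_{|\gamma|\le\bar r_n}\mathrm{ch}_1(V_\gamma)$ (over models at stage $n$); $u_n\prec v_n$ means $u_n/v_n\to0$. **Theorem.** Let $\varepsilon_n\in(0,1]$ for each $n$ with $1\prec n\varepsilon_n^2$, and suppose that (2) $\bar r_n\ln(1/\varepsilon_n^2)\prec n\varepsilon_n^2$; (3) $\bar r_n\ln K_n\prec n\varepsilon_n^2$; (4) $\bar r_n\ln D\big(\bar r_n\sqrt{n\varepsilon_n^2\tilde B_n}\big)\prec n\varepsilon_n^2$; (5) $1\le r_n\le\bar r_n<K_n$ for each $n$; (6) $1\prec r_n\prec K_n$; (7) $\Delta(r_n)\prec\varepsilon_n^2$; (8) $B(r_n)\prec n\varepsilon_n^2$; (9) $r_n\ln\bar B(r_n)\prec n\varepsilon_n^2$. Then: (i) for some $r_0>0$, $\lim_{n\to\infty}P^*\{\pi[d(p,p^*)\le\varepsilon_n|D^n]\ge1-e^{-r_0n\varepsilon_n^2}\}=1$; (ii) for some $c_1>0$ and all sufficiently large $n$, $P^*\{\pi[d(p,p^*)>\varepsilon_n|D^n]\ge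 e^{-0.5c_1n\varepsilon_n^2}\}\le e^{-0.5c_1n\varepsilon_n^2}$; (iii) for some $c_1>0$ and all sufficiently large $n$, $E^*_{D^n}\,\pi[d(p,p^*)>\varepsilon_n|D^n]\le e^{-c_1n\varepsilon_n^2}$. -/

import Mathlib

open MeasureTheory ProbabilityTheory Filter Topology
open scoped ENNReal BigOperators

noncomputable section

namespace BVS

/-- A generalized linear model with one natural parameter: the conditional densities
`f(y, h) = exp (a(h) y + b(h) + c(y))` with respect to the dominating measure `ν` of the response,
indexed by the linear parameter `h : ℝ`. (Restrictions on the range of the response are encoded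
in `ν`, for example counting measure on `{0, 1}` or Lebesgue measure on `(0, ∞)`.) -/
structure GLM where
  a : ℝ → ℝ
  b : ℝ → ℝ
  c : ℝ → ℝ
  ν : Measure ℝ
  sigmaFinite : SigmaFinite ν
  contDiff_a : ContDiff ℝ 1 a
  contDiff_b : ContDiff ℝ 1 b
  measurable_c : Measurable c
  deriv_a_ne_zero : ∀ h, deriv a h ≠ 0
  lintegral_density : ∀ h, ∫⁻ y, ENNReal.ofReal (Real.exp (a h * y + b h + c y)) ∂ν = 1

instance (M : GLM) : SigmaFinite M.ν := M.sigmaFinite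

/-- The density `f(y, h)`. -/
def GLM.f (M : GLM) (y h : ℝ) : ℝ := Real.exp (M.a h * y + M.b h + M.c y)

/-- The mean function `ψ = - b' / a'`. -/
def GLM.ψ (M : GLM) (h : ℝ) : ℝ := - deriv M.b h / deriv M.a h

/-- `D(R) = 1 + R * sup_{|h| ≤ R} |a'(h)| * sup_{|h| ≤ R} |ψ(h)|`. -/
def GLM.D (M : GLM) (R : ℝ) : ℝ :=
  1 + R * (⨆ h : Set.Icc (-R) R, |deriv M.a h|) * (⨆ h : Set.Icc (-R) R, |M.ψ h|)

/-- One observation `(x, y)`: covariates in `ℝ^K` and a real response. -/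
abbrev Obs (K : ℕ) : Type := (Fin K → ℝ) × ℝ

/-- The dominating measure `ν_x(dx) ν_y(dy)` of one observation. -/
def GLM.dom (M : GLM) {K : ℕ} (νx : Measure (Fin K → ℝ)) : Measure (Obs K) := νx.prod M.ν

/-- The true density `p*(y, x) = f(y, xᵀβ*)`. -/
def GLM.trueDensity (M : GLM) {K : ℕ} (β : Fin K → ℝ) (z : Obs K) : ℝ :=
  M.f z.2 (∑ j, z.1 j * β j)

/-- The law of one observation under the truth. -/
def GLM.trueLaw (M : GLM) {K : ℕ} (νx : Measure (Fin K → ℝ)) (β : Fin K → ℝ) :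
    Measure (Obs K) :=
  (M.dom νx).withDensity fun z => ENNReal.ofReal (M.trueDensity β z)

/-- `P*`, the law of the data set `Dⁿ` of `n` i.i.d. observations. -/
def GLM.dataLaw (M : GLM) {K : ℕ} (νx : Measure (Fin K → ℝ)) (β : Fin K → ℝ) (n : ℕ) :
    Measure (Fin n → Obs K) :=
  Measure.pi fun _ => M.trueLaw νx β

/-- The parameters `(γ, β_γ)`: a subset of the covariates and a coefficient for each of its
members. -/
abbrev Param (K : ℕ) : Type := Σ γ : Finset (Fin K), EuclideanSpace ℝ γ

/-- The density `p(y, x | γ, β_γ) = f(y, x_γᵀ β_γ)`. -/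
def GLM.density (M : GLM) {K : ℕ} (θ : Param K) (z : Obs K) : ℝ :=
  M.f z.2 (∑ j : θ.1, z.1 j * θ.2 j)

/-- The Hellinger distance `d(p, p*)` between the density with parameter `θ` and the true one. -/
def GLM.hellinger (M : GLM) {K : ℕ} (νx : Measure (Fin K → ℝ)) (β : Fin K → ℝ)
    (θ : Param K) : ℝ :=
  Real.sqrt (∫ z, (Real.sqrt (M.density θ z) - Real.sqrt (M.trueDensity β z)) ^ 2 ∂(M.dom νx))

/-- The probability of `γ` when the `K` inclusion indicators are i.i.d. with success
probability `lam`. -/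
def bernoulliWeight {K : ℕ} (lam : ℝ) (γ : Finset (Fin K)) : ℝ :=
  ∏ j, if j ∈ γ then lam else 1 - lam

/-- The prior probability of the model `γ`: i.i.d. inclusion indicators with success probability
`r / K`, conditioned on the model size being at most `rbar`. -/
def modelPrior {K : ℕ} (r rbar : ℕ) (γ : Finset (Fin K)) : ℝ :=
  (if γ.card ≤ rbar then bernoulliWeight ((r : ℝ) / K) γ else 0) /
    ∑ γ' : Finset (Fin K), if γ'.card ≤ rbar then bernoulliWeight ((r : ℝ) / K) γ' else 0

/-- The prior on `(γ, β_γ)`: `γ` follows `modelPrior`, and `β_γ ∼ N(0, V_γ)` given `γ`. -/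
def prior {K : ℕ} (r rbar : ℕ) (V : (γ : Finset (Fin K)) → Matrix γ γ ℝ) :
    Measure (Param K) :=
  ∑ γ : Finset (Fin K), ENNReal.ofReal (modelPrior r rbar γ) •
    (multivariateGaussian (0 : EuclideanSpace ℝ γ) (V γ)).map fun v => (⟨γ, v⟩ : Param K)

/-- The likelihood of `θ` given the data. -/
def GLM.likelihood (M : GLM) {K n : ℕ} (data : Fin n → Obs K) (θ : Param K) : ℝ≥0∞ :=
  ∏ i, ENNReal.ofReal (M.density θ (data i))

/-- The posterior `π(· | Dⁿ)`: the prior reweighted by the likelihood and normalized. -/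
def GLM.posterior (M : GLM) {K n : ℕ} (π : Measure (Param K)) (data : Fin n → Obs K) :
    Measure (Param K) :=
  (∫⁻ θ, M.likelihood data θ ∂π)⁻¹ • π.withDensity (M.likelihood data)

/-- The largest eigenvalue `ch₁` of a real symmetric matrix. -/
def ch₁ {ι : Type*} [Fintype ι] [DecidableEq ι] (A : Matrix ι ι ℝ) : ℝ := sSup (spectrum ℝ A)

/-- `Δ(r) = inf_{|γ| = r} ∑_{j ∉ γ} |β*_j|`. -/
def tailSum {K : ℕ} (β : Fin K → ℝ) (r : ℕ) : ℝ :=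
  ⨅ γ : {γ : Finset (Fin K) // γ.card = r}, ∑ j ∈ γ.1ᶜ, |β j|

/-- `B(r) = sup_{|γ| = r} ch₁(V_γ⁻¹)`. -/
def supInvEig {K : ℕ} (V : (γ : Finset (Fin K)) → Matrix γ γ ℝ) (r : ℕ) : ℝ :=
  ⨆ γ : {γ : Finset (Fin K) // γ.card = r}, ch₁ ((V γ.1)⁻¹)

/-- `B̄(r) = sup_{|γ| = r} ch₁(V_γ)`. -/
def supEig {K : ℕ} (V : (γ : Finset (Fin K)) → Matrix γ γ ℝ) (r : ℕ) : ℝ :=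
  ⨆ γ : {γ : Finset (Fin K) // γ.card = r}, ch₁ (V γ.1)

/-- `sup_{|γ| ≤ rbar} ch₁(V_γ)`. -/
def supEigLe {K : ℕ} (V : (γ : Finset (Fin K)) → Matrix γ γ ℝ) (rbar : ℕ) : ℝ :=
  ⨆ γ : {γ : Finset (Fin K) // γ.card ≤ rbar}, ch₁ (V γ.1)

/-- `u ≺ v`, that is, `u_n / v_n → 0`. -/
def Prec (u v : ℕ → ℝ) : Prop := Tendsto (fun n => u n / v n) atTop (𝓝 0)

end BVS

end

/-! Work with likelihood ratios against the truth: the product of true densities cancels in the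
posterior, so the mass of the far set is a numerator divided by an evidence, both averages of ratios
over the prior. Write u = n ε².

The evidence is bounded below by a second-moment argument (`evidence_lower_bound`). Integrating 2 ≤
L/m + m/L over a prior neighbourhood G and applying Markov's inequality shows that the evidence
drops below m π(G) with probability at most m Aⁿ, where A bounds ∫ p*²/p on G. In the exponential
family p*²/p is, up to a constant, another member of the family, so A is close to 1 as soon as the
linear predictors are close (`exists_chiSq_le`). A set G of prior mass at least exp(-u/32) consists
of the coefficients near β* in the best model of size r (`le_prior_neighbourhood`); the tail,
eigenvalue and model-size conditions are used there.

The numerator is split by a sieve. Coefficients beyond C = √(u B̃) have exponentially small prior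
mass by Gaussian tails, and the expected numerator over a set is at most its prior mass. The rest is
cut into cells on which the linear predictors hardly vary. Since `a` is monotone, the densities of a
cell lie below a multiple of the larger of two endpoint densities, whatever the sign or size of y,
so no moment condition on the response is needed. If the cell is far from the truth in Hellinger
distance, this envelope has affinity at most exp(-ε²/4) with the truth (`GLM.exists_envelope`).

No tests are constructed. The posterior mass of a cell is at most 1, hence at most the square root
of any upper bound for it; the expected square root of a product of n envelope ratios is the n-th
power of an affinity. Summing over at most exp(u/16) cells gives `exists_posterior_majorant` and
then `eventually_exists_majorant`: the far mass has a majorant of expectation at most exp(-u/64).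
The third conclusion is this bound, the second follows by Markov's inequality, the first by
complementation. -/

noncomputable section

namespace BVS

/-! ### Hellinger distance and affinity. -/

section SqrtIdentity

variable {α : Type*} [MeasurableSpace α] {μ : Measure α}

/-- For two probability densities, squared Hellinger distance plus twice the affinity is `2`. -/
lemma lintegral_sq_sqrt_sub_add {p q : α → ℝ} (hp : Measurable p) (hq : Measurable q)
    (hp0 : ∀ z, 0 ≤ p z) (hq0 : ∀ z, 0 ≤ q z)
    (hp1 : ∫⁻ z, ENNReal.ofReal (p z) ∂μ = 1) (hq1 : ∫⁻ z, ENNReal.ofReal (q z) ∂μ = 1) :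
    ∫⁻ z, ENNReal.ofReal ((√(p z) - √(q z)) ^ 2) ∂μ +
      2 * ∫⁻ z, ENNReal.ofReal (√(p z) * √(q z)) ∂μ = 2 := by
  rw [← lintegral_const_mul _ (by fun_prop), ← lintegral_add_left (by fun_prop)]
  have : ∀ z, ENNReal.ofReal ((√(p z) - √(q z)) ^ 2) + 2 * ENNReal.ofReal (√(p z) * √(q z)) =
      ENNReal.ofReal (p z) + ENNReal.ofReal (q z) := by
    intro z
    rw [← ENNReal.ofReal_ofNat 2, ← ENNReal.ofReal_mul (by norm_num),
      ← ENNReal.ofReal_add (by positivity) (by positivity),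
      ← ENNReal.ofReal_add (hp0 z) (hq0 z)]
    congr 1
    nlinarith [Real.sq_sqrt (hp0 z), Real.sq_sqrt (hq0 z)]
  simp_rw [this]
  rw [lintegral_add_left (by fun_prop), hp1, hq1]
  norm_num

end SqrtIdentity

/-! ### Affinity, envelope and chi-square bounds in the exponential family. -/

namespace GLM

variable (M : GLM)

@[fun_prop]
lemma continuous_a : Continuous M.a := M.contDiff_a.continuous

@[fun_prop]
lemma continuous_b : Continuous M.b := M.contDiff_b.continuous

lemma continuous_deriv_a : Continuous (deriv M.a) := M.contDiff_a.continuous_deriv le_rfl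

lemma continuous_deriv_b : Continuous (deriv M.b) := M.contDiff_b.continuous_deriv le_rfl

lemma differentiable_a : Differentiable ℝ M.a := M.contDiff_a.differentiable one_ne_zero

lemma differentiable_b : Differentiable ℝ M.b := M.contDiff_b.differentiable one_ne_zero

lemma measurable_f : Measurable fun p : ℝ × ℝ => M.f p.1 p.2 := by
  have ha := M.continuous_a.measurable
  have hb := M.continuous_b.measurable
  have hc := M.measurable_c
  unfold GLM.f
  fun_prop

@[fun_prop]
lemma measurable_f_comp {α : Type*} [MeasurableSpace α] {g h : α → ℝ} (hg : Measurable g)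
    (hh : Measurable h) : Measurable fun x => M.f (g x) (h x) :=
  M.measurable_f.comp (hg.prodMk hh)

lemma f_pos (y h : ℝ) : 0 < M.f y h := Real.exp_pos _

lemma sqrt_f (y h : ℝ) : √(M.f y h) = Real.exp ((M.a h * y + M.b h + M.c y) / 2) := by
  rw [GLM.f, Real.exp_half]

lemma lintegral_f (h : ℝ) : ∫⁻ y, ENNReal.ofReal (M.f y h) ∂M.ν = 1 := M.lintegral_density h

/-- A wrong normalizing exponent costs exactly its difference from `b h`. All integrals of products
and quotients of densities below are evaluated this way, after finding the parameter that matches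
the coefficient of y. -/
lemma lintegral_exp (h B : ℝ) :
    ∫⁻ y, ENNReal.ofReal (Real.exp (M.a h * y + B + M.c y)) ∂M.ν =
      ENNReal.ofReal (Real.exp (B - M.b h)) := by
  have : ∀ y, ENNReal.ofReal (Real.exp (M.a h * y + B + M.c y)) =
      ENNReal.ofReal (Real.exp (B - M.b h)) * ENNReal.ofReal (M.f y h) := by
    intro y
    rw [← ENNReal.ofReal_mul (Real.exp_pos _).le, GLM.f, ← Real.exp_add]
    congr 2
    ring
  simp_rw [this]
  rw [lintegral_const_mul _ (by fun_prop), lintegral_f, mul_one]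

/-- The product of the two suprema in `GLM.D`, which bounds `|b'|` on `[-R, R]`. -/
def slope (R : ℝ) : ℝ :=
  (⨆ h : Set.Icc (-R) R, |deriv M.a h|) * (⨆ h : Set.Icc (-R) R, |M.ψ h|)

lemma D_eq (R : ℝ) : M.D R = 1 + R * M.slope R := by
  rw [GLM.D, slope, mul_assoc]

lemma slope_nonneg (R : ℝ) : 0 ≤ M.slope R :=
  mul_nonneg (Real.iSup_nonneg fun _ => abs_nonneg _) (Real.iSup_nonneg fun _ => abs_nonneg _)

lemma le_iSup_Icc {g : ℝ → ℝ} (hg : Continuous g) {R h : ℝ} (hh : h ∈ Set.Icc (-R) R) :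
    g h ≤ ⨆ h : Set.Icc (-R) R, g h := by
  have hb : BddAbove (Set.range fun h : Set.Icc (-R) R => g h) := by
    have := (isCompact_Icc (a := -R) (b := R)).bddAbove_image hg.continuousOn
    rwa [Set.image_eq_range] at this
  exact le_ciSup hb (⟨h, hh⟩ : Set.Icc (-R) R)

/-- The identity b' = -a' ψ turns the two suprema in `GLM.D` into a Lipschitz constant for `b`,
which is the only way they enter the proof. -/
lemma abs_deriv_b_le {R h : ℝ} (hh : h ∈ Set.Icc (-R) R) : |deriv M.b h| ≤ M.slope R := by
  have hψ : Continuous M.ψ := by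
    unfold GLM.ψ
    exact M.continuous_deriv_b.neg.div M.continuous_deriv_a M.deriv_a_ne_zero
  have e : |deriv M.b h| = |deriv M.a h| * |M.ψ h| := by
    have := M.deriv_a_ne_zero h
    rw [← abs_mul, GLM.ψ, mul_div_cancel₀ _ this, abs_neg]
  rw [e, slope]
  exact mul_le_mul (le_iSup_Icc (M.continuous_deriv_a.abs) hh) (le_iSup_Icc hψ.abs hh)
    (abs_nonneg _) (Real.iSup_nonneg fun _ => abs_nonneg _)

lemma abs_b_sub_le {R h₁ h₂ : ℝ} (hh₁ : h₁ ∈ Set.Icc (-R) R) (hh₂ : h₂ ∈ Set.Icc (-R) R) :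
    |M.b h₁ - M.b h₂| ≤ M.slope R * |h₁ - h₂| :=
  (convex_Icc (-R) R).norm_image_sub_le_of_norm_deriv_le (f := M.b)
    (fun x _ => M.differentiable_b x) (fun _ hx => M.abs_deriv_b_le hx) hh₂ hh₁

/-- The geometric mean of two members of the family is a multiple of the member whose natural
parameter is the midpoint of a(h₁) and a(h₂). By the intermediate value theorem that member sits
between h₁ and h₂, so the multiple is controlled by the Lipschitz bound on `b`. -/
lemma affinity_ge {R h₁ h₂ : ℝ} (hh₁ : h₁ ∈ Set.Icc (-R) R) (hh₂ : h₂ ∈ Set.Icc (-R) R) :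
    ENNReal.ofReal (Real.exp (-(M.slope R * |h₁ - h₂|))) ≤
      ∫⁻ y, ENNReal.ofReal (√(M.f y h₁) * √(M.f y h₂)) ∂M.ν := by
  obtain ⟨h, hh, hah⟩ : (M.a h₁ + M.a h₂) / 2 ∈ M.a '' Set.uIcc h₁ h₂ := by
    apply intermediate_value_uIcc M.continuous_a.continuousOn
    rw [Set.mem_uIcc]
    rcases le_total (M.a h₁) (M.a h₂) with h | h
    · left; constructor <;> linarith
    · right; constructor <;> linarith
  have hR : h ∈ Set.Icc (-R) R := Set.uIcc_subset_Icc hh₁ hh₂ hh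
  have e : ∀ y, √(M.f y h₁) * √(M.f y h₂) =
      Real.exp (M.a h * y + (M.b h₁ + M.b h₂) / 2 + M.c y) := by
    intro y
    rw [sqrt_f, sqrt_f, ← Real.exp_add, hah]
    congr 1
    ring
  simp_rw [e]
  rw [lintegral_exp]
  apply ENNReal.ofReal_le_ofReal
  apply Real.exp_le_exp.2
  have l₁ : |h₁ - h| ≤ |h₁ - h₂| := by
    rw [abs_sub_comm, abs_sub_comm h₁]
    exact Set.abs_sub_left_of_mem_uIcc hh
  have l₂ : |h₂ - h| ≤ |h₁ - h₂| := by
    rw [abs_sub_comm h₁]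
    rw [Set.uIcc_comm] at hh
    rw [abs_sub_comm, abs_sub_comm h₂]
    exact Set.abs_sub_left_of_mem_uIcc hh
  have b₁ := (M.abs_b_sub_le hh₁ hR).trans (mul_le_mul_of_nonneg_left l₁ (M.slope_nonneg R))
  have b₂ := (M.abs_b_sub_le hh₂ hR).trans (mul_le_mul_of_nonneg_left l₂ (M.slope_nonneg R))
  have := (abs_le.1 b₁).1
  have := (abs_le.1 b₂).1
  linarith

lemma lintegral_sq_sqrt_f_sub_le {R h₁ h₂ : ℝ} (hh₁ : h₁ ∈ Set.Icc (-R) R)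
    (hh₂ : h₂ ∈ Set.Icc (-R) R) :
    ∫⁻ y, ENNReal.ofReal ((√(M.f y h₁) - √(M.f y h₂)) ^ 2) ∂M.ν ≤
      ENNReal.ofReal (2 * (M.slope R * |h₁ - h₂|)) := by
  set t := M.slope R * |h₁ - h₂|
  have h := lintegral_sq_sqrt_sub_add (μ := M.ν) (p := fun y => M.f y h₁) (q := fun y => M.f y h₂)
    (by fun_prop) (by fun_prop) (fun y => (M.f_pos y h₁).le) (fun y => (M.f_pos y h₂).le)
    (M.lintegral_f h₁) (M.lintegral_f h₂)
  have h' := M.affinity_ge hh₁ hh₂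
  have l : ∫⁻ y, ENNReal.ofReal ((√(M.f y h₁) - √(M.f y h₂)) ^ 2) ∂M.ν +
      ENNReal.ofReal (2 * Real.exp (-t)) ≤ ENNReal.ofReal 2 := by
    rw [ENNReal.ofReal_mul (by norm_num), ENNReal.ofReal_ofNat]
    exact (by gcongr : _ ≤ _).trans h.le
  refine (ENNReal.le_sub_of_add_le_right ENNReal.ofReal_ne_top l).trans ?_
  rw [← ENNReal.ofReal_sub _ (by positivity)]
  apply ENNReal.ofReal_le_ofReal
  linarith [Real.add_one_le_exp (-t)]

/-- `a` is strictly monotone: some sign `σ` makes `σ a'` positive. -/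
lemma exists_sign : ∃ σ : ℝ, (σ = 1 ∨ σ = -1) ∧ ∀ h, σ * deriv M.a h = |deriv M.a h| := by
  by_cases hpos : ∀ h, 0 ≤ deriv M.a h
  · exact ⟨1, Or.inl rfl, fun h => by rw [one_mul, abs_of_nonneg (hpos h)]⟩
  · refine ⟨-1, Or.inr rfl, fun h => ?_⟩
    push Not at hpos
    have : deriv M.a h ≤ 0 := by
      by_contra! hh
      obtain ⟨x, hx⟩ := mem_range_of_exists_le_of_exists_ge M.continuous_deriv_a (c := 0)
        (hpos.imp fun _ h => h.le) ⟨h, hh.le⟩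
      exact M.deriv_a_ne_zero x hx
    rw [abs_of_nonpos this]
    ring

/-- For fixed y the map h ↦ a(h) y is monotone, with a direction that depends on the sign of y; the
maximum over both endpoints covers either direction. This makes two endpoint densities enough for an
envelope. -/
lemma a_mul_le_max {h₁ h h₂ : ℝ} (l₁ : h₁ ≤ h) (l₂ : h ≤ h₂) (y : ℝ) :
    M.a h * y ≤ max (M.a h₁ * y) (M.a h₂ * y) := by
  obtain ⟨σ, hσ, hd⟩ := M.exists_sign
  have mono : Monotone fun h => σ * M.a h := by
    apply monotone_of_deriv_nonneg (M.differentiable_a.const_mul σ)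
    intro x
    rw [deriv_const_mul_field, hd]
    exact abs_nonneg _
  have m₁ := mono l₁
  have m₂ := mono l₂
  simp only at m₁ m₂
  rcases hσ with rfl | rfl <;> rcases le_total 0 y with hy | hy
  · exact le_max_of_le_right (mul_le_mul_of_nonneg_right (by linarith) hy)
  · exact le_max_of_le_left (mul_le_mul_of_nonpos_right (by linarith) hy)
  · exact le_max_of_le_left (mul_le_mul_of_nonneg_right (by linarith) hy)
  · exact le_max_of_le_right (mul_le_mul_of_nonpos_right (by linarith) hy)

/-- An upper envelope of the densities `f(·, h)` with `|h - h₀| ≤ δ` and `|h| ≤ R`. -/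
def upper (R δ h₀ y : ℝ) : ℝ :=
  Real.exp (2 * (δ * M.slope R)) * max (M.f y (max (h₀ - δ) (-R))) (M.f y (min (h₀ + δ) R))

@[fun_prop]
lemma measurable_upper_comp {α : Type*} [MeasurableSpace α] (R δ : ℝ) {g h : α → ℝ}
    (hg : Measurable g) (hh : Measurable h) : Measurable fun x => M.upper R δ (h x) (g x) := by
  unfold upper
  fun_prop

lemma upper_pos (R δ h₀ y : ℝ) : 0 < M.upper R δ h₀ y :=
  mul_pos (Real.exp_pos _) (lt_max_of_lt_left (M.f_pos _ _))

lemma lower_mem_Icc {R δ h₀ : ℝ} (hδ : 0 ≤ δ) (hh₀ : h₀ ∈ Set.Icc (-R) R) :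
    max (h₀ - δ) (-R) ∈ Set.Icc (-R) R ∧ |max (h₀ - δ) (-R) - h₀| ≤ δ := by
  obtain ⟨h1, h2⟩ := hh₀
  refine ⟨⟨le_max_right _ _, max_le (by linarith) (by linarith)⟩, ?_⟩
  rw [abs_le]
  refine ⟨by linarith [le_max_left (h₀ - δ) (-R)], ?_⟩
  have : max (h₀ - δ) (-R) ≤ h₀ := max_le (by linarith) h1
  linarith

lemma upper_mem_Icc {R δ h₀ : ℝ} (hδ : 0 ≤ δ) (hh₀ : h₀ ∈ Set.Icc (-R) R) :
    min (h₀ + δ) R ∈ Set.Icc (-R) R ∧ |min (h₀ + δ) R - h₀| ≤ δ := by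
  obtain ⟨h1, h2⟩ := hh₀
  refine ⟨⟨le_min (by linarith) (by linarith), min_le_right _ _⟩, ?_⟩
  rw [abs_le]
  refine ⟨?_, by linarith [min_le_left (h₀ + δ) R]⟩
  have : h₀ ≤ min (h₀ + δ) R := le_min (by linarith) h2
  linarith

/-- Moving h to the dominating endpoint does not decrease the term in y, and changes `b` by at most
2δ times the slope, which is the exponential factor of the envelope. -/
lemma f_le_upper {R δ h₀ h : ℝ} (hδ : 0 ≤ δ) (hh₀ : h₀ ∈ Set.Icc (-R) R)
    (hh : h ∈ Set.Icc (-R) R) (hd : |h - h₀| ≤ δ) (y : ℝ) : M.f y h ≤ M.upper R δ h₀ y := by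
  obtain ⟨m₁, d₁⟩ := lower_mem_Icc hδ hh₀
  obtain ⟨m₂, d₂⟩ := upper_mem_Icc hδ hh₀
  obtain ⟨e₁, e₂⟩ := abs_le.1 hd
  have l₁ : max (h₀ - δ) (-R) ≤ h := max_le (by linarith) hh.1
  have l₂ : h ≤ min (h₀ + δ) R := le_min (by linarith) hh.2
  unfold upper
  set h₁ := max (h₀ - δ) (-R)
  set h₂ := min (h₀ + δ) R
  have S0 := M.slope_nonneg R
  have key : ∀ h', h' ∈ Set.Icc (-R) R → |h' - h₀| ≤ δ → M.a h * y ≤ M.a h' * y →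
      M.f y h ≤ Real.exp (2 * (δ * M.slope R)) * M.f y h' := by
    intro h' m' d' ha
    rw [GLM.f, GLM.f, ← Real.exp_add]
    apply Real.exp_le_exp.2
    have hb := (abs_le.1 (M.abs_b_sub_le hh m')).2
    have : |h - h'| ≤ 2 * δ := by
      rw [abs_sub_comm] at d'
      linarith [abs_sub_le h h₀ h']
    nlinarith
  rcases le_max_iff.1 (M.a_mul_le_max l₁ l₂ y) with ha | ha
  · exact (key h₁ m₁ d₁ ha).trans (mul_le_mul_of_nonneg_left (le_max_left _ _) (Real.exp_pos _).le)
  · exact (key h₂ m₂ d₂ ha).trans (mul_le_mul_of_nonneg_left (le_max_right _ _) (Real.exp_pos _).le)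

/-- Expand the root of the larger endpoint density about √f(y, h₀) and apply weighted AM-GM to the
increment. Both endpoints are kept so that the bound does not depend on which is larger; t is free,
to be balanced after integration. -/
lemma sqrt_upper_mul_le {R δ h₀ y t s : ℝ} (ht : 0 < t) :
    √(M.upper R δ h₀ y) * √(M.f y s) ≤ Real.exp (δ * M.slope R) *
      (√(M.f y h₀) * √(M.f y s) +
        (t * (√(M.f y (max (h₀ - δ) (-R))) - √(M.f y h₀)) ^ 2 +
        (t * (√(M.f y (min (h₀ + δ) R)) - √(M.f y h₀)) ^ 2 + M.f y s / (2 * t)))) := by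
  unfold upper
  set f₁ := M.f y (max (h₀ - δ) (-R))
  set f₂ := M.f y (min (h₀ + δ) R)
  set f₀ := M.f y h₀
  set fs := M.f y s
  have e : √(Real.exp (2 * (δ * M.slope R)) * max f₁ f₂) =
      Real.exp (δ * M.slope R) * √(max f₁ f₂) := by
    rw [Real.sqrt_mul (Real.exp_pos _).le, ← Real.exp_half, mul_div_cancel_left₀ _ two_ne_zero]
  rw [e, mul_assoc]
  apply mul_le_mul_of_nonneg_left _ (Real.exp_pos _).le
  have amgm : ∀ u v : ℝ, u * v ≤ t * u ^ 2 + v ^ 2 / (4 * t) := by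
    intro u v
    have : t * u ^ 2 + v ^ 2 / (4 * t) - u * v = (2 * t * u - v) ^ 2 / (4 * t) := by
      field_simp; ring
    have : 0 ≤ (2 * t * u - v) ^ 2 / (4 * t) := by positivity
    linarith
  have hs : √fs ^ 2 = fs := Real.sq_sqrt (M.f_pos _ _).le
  have hs0 : 0 < fs := M.f_pos _ _
  have two : fs / (2 * t) = fs / (4 * t) + fs / (4 * t) := by field_simp; ring
  have p₁ := amgm (√f₁ - √f₀) √fs
  have p₂ := amgm (√f₂ - √f₀) √fs
  rw [hs] at p₁ p₂
  have q0 : 0 ≤ fs / (4 * t) := by positivity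
  have q1 : 0 ≤ t * (√f₁ - √f₀) ^ 2 := by positivity
  have q2 : 0 ≤ t * (√f₂ - √f₀) ^ 2 := by positivity
  rcases le_total f₁ f₂ with h | h
  · rw [max_eq_right h]; linarith
  · rw [max_eq_left h]; linarith

lemma lintegral_sqrt_upper_mul_le {R δ h₀ s ε : ℝ} (hδ : 0 ≤ δ) (hε : 0 < ε)
    (hδε : δ * M.slope R ≤ ε ^ 4 / 512) (hh₀ : h₀ ∈ Set.Icc (-R) R) :
    ∫⁻ y, ENNReal.ofReal (√(M.upper R δ h₀ y) * √(M.f y s)) ∂M.ν ≤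
      ENNReal.ofReal (Real.exp (δ * M.slope R)) *
        (∫⁻ y, ENNReal.ofReal (√(M.f y h₀) * √(M.f y s)) ∂M.ν + ENNReal.ofReal (ε ^ 2 / 8)) := by
  -- With this weight each squared increment integrates to at most ε²/32 and the remaining term to
  -- ε²/16, in total ε²/8.
  set t := 8 / ε ^ 2 with ht
  have t0 : 0 < t := by positivity
  have S0 := M.slope_nonneg R
  obtain ⟨m₁, d₁⟩ := lower_mem_Icc hδ hh₀
  obtain ⟨m₂, d₂⟩ := upper_mem_Icc hδ hh₀
  have hell : ∀ h', h' ∈ Set.Icc (-R) R → |h' - h₀| ≤ δ →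
      ENNReal.ofReal t * ∫⁻ y, ENNReal.ofReal ((√(M.f y h') - √(M.f y h₀)) ^ 2) ∂M.ν ≤
        ENNReal.ofReal (ε ^ 2 / 32) := by
    intro h' m' d'
    calc _ ≤ ENNReal.ofReal t * ENNReal.ofReal (2 * (M.slope R * |h' - h₀|)) := by
          gcongr; exact M.lintegral_sq_sqrt_f_sub_le m' hh₀
      _ = ENNReal.ofReal (t * (2 * (M.slope R * |h' - h₀|))) := by
          rw [ENNReal.ofReal_mul t0.le]
      _ ≤ _ := by
          apply ENNReal.ofReal_le_ofReal
          have : 2 * (M.slope R * |h' - h₀|) ≤ ε ^ 4 / 256 := by nlinarith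
          calc _ ≤ t * (ε ^ 4 / 256) := mul_le_mul_of_nonneg_left this t0.le
            _ = ε ^ 2 / 32 := by rw [ht]; field_simp; ring
  calc _ ≤ ∫⁻ y, ENNReal.ofReal (Real.exp (δ * M.slope R)) *
      (ENNReal.ofReal (√(M.f y h₀) * √(M.f y s)) +
        (ENNReal.ofReal t * ENNReal.ofReal ((√(M.f y (max (h₀ - δ) (-R))) - √(M.f y h₀)) ^ 2) +
        (ENNReal.ofReal t * ENNReal.ofReal ((√(M.f y (min (h₀ + δ) R)) - √(M.f y h₀)) ^ 2) +
          ENNReal.ofReal (1 / (2 * t)) * ENNReal.ofReal (M.f y s)))) ∂M.ν := by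
        apply lintegral_mono
        intro y
        have := (M.f_pos y s).le
        dsimp only
        rw [← ENNReal.ofReal_mul t0.le, ← ENNReal.ofReal_mul t0.le,
          ← ENNReal.ofReal_mul (by positivity), ← ENNReal.ofReal_add (by positivity)
          (by positivity), ← ENNReal.ofReal_add (by positivity) (by positivity),
          ← ENNReal.ofReal_add (by positivity) (by positivity),
          ← ENNReal.ofReal_mul (by positivity)]
        apply ENNReal.ofReal_le_ofReal
        rw [one_div_mul_eq_div]
        exact M.sqrt_upper_mul_le t0
    _ = ENNReal.ofReal (Real.exp (δ * M.slope R)) *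
      (∫⁻ y, ENNReal.ofReal (√(M.f y h₀) * √(M.f y s)) ∂M.ν +
        (ENNReal.ofReal t *
          ∫⁻ y, ENNReal.ofReal ((√(M.f y (max (h₀ - δ) (-R))) - √(M.f y h₀)) ^ 2) ∂M.ν +
        (ENNReal.ofReal t *
          ∫⁻ y, ENNReal.ofReal ((√(M.f y (min (h₀ + δ) R)) - √(M.f y h₀)) ^ 2) ∂M.ν +
          ENNReal.ofReal (1 / (2 * t)) * 1))) := by
        rw [lintegral_const_mul _ (by fun_prop), lintegral_add_left (by fun_prop),
          lintegral_add_left (by fun_prop), lintegral_add_left (by fun_prop),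
          lintegral_const_mul _ (by fun_prop), lintegral_const_mul _ (by fun_prop),
          lintegral_const_mul _ (by fun_prop), lintegral_f]
    _ ≤ ENNReal.ofReal (Real.exp (δ * M.slope R)) *
      (∫⁻ y, ENNReal.ofReal (√(M.f y h₀) * √(M.f y s)) ∂M.ν +
        (ENNReal.ofReal (ε ^ 2 / 32) + (ENNReal.ofReal (ε ^ 2 / 32) +
          ENNReal.ofReal (1 / (2 * t)) * 1))) := by
        gcongr
        · exact hell _ m₁ d₁
        · exact hell _ m₂ d₂
    _ = _ := by
        rw [mul_one, ← ENNReal.ofReal_add (by positivity) (by positivity),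
          ← ENNReal.ofReal_add (by positivity) (by positivity)]
        congr 3
        rw [ht]
        field_simp
        ring

/-- Near the truth, `∫ f(y, s)² / f(y, h) dν` is at most `exp (C |h - s|)`, locally uniformly. -/
lemma exists_chiSq_le (B : ℝ) : ∃ C η₀ : ℝ, 0 < C ∧ 0 < η₀ ∧ ∀ s h η : ℝ, |s| ≤ B → η ≤ η₀ →
    |h - s| ≤ η → ∫⁻ y, ENNReal.ofReal (M.f y s / M.f y h * M.f y s) ∂M.ν ≤
      ENNReal.ofReal (Real.exp (C * η)) := by
  -- The interval is widened by 1 because both h and the reflected parameter h' below stay within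
  -- distance 1 of s.
  set I := Set.Icc (-(|B| + 1)) (|B| + 1) with hI
  have hIne : I.Nonempty := ⟨0, by constructor <;> linarith [abs_nonneg B]⟩
  have hIc : IsCompact I := isCompact_Icc
  obtain ⟨x₀, -, hx₀⟩ := hIc.exists_isMinOn hIne M.continuous_deriv_a.abs.continuousOn
  obtain ⟨x₁, -, hx₁⟩ := hIc.exists_isMaxOn hIne M.continuous_deriv_a.abs.continuousOn
  set m := |deriv M.a x₀|
  set A := |deriv M.a x₁|
  have m0 : 0 < m := abs_pos.2 (M.deriv_a_ne_zero x₀)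
  have A0 : 0 < A := abs_pos.2 (M.deriv_a_ne_zero x₁)
  have S0 := M.slope_nonneg (|B| + 1)
  obtain ⟨σ, hσ, hd⟩ := M.exists_sign
  -- Reflecting a(h) about a(s) moves the parameter by at most ρ = Aη/m, where m and A are the
  -- extremes of |a'| on `I`. The constant pays for the moves of h and h' in `b`; the threshold
  -- forces η ≤ 1 and ρ ≤ 1.
  refine ⟨(M.slope (|B| + 1) + 1) * (1 + A / m), min 1 (m / A), by positivity, by positivity, ?_⟩
  intro s h η hs hη hh
  have hη0 : 0 ≤ η := (abs_nonneg _).trans hh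
  have hη1 : η ≤ 1 := hη.trans (min_le_left _ _)
  set ρ := A * η / m with hρ
  have hρ0 : 0 ≤ ρ := by positivity
  have hρ1 : ρ ≤ 1 := by
    rw [hρ, div_le_one m0]
    calc A * η ≤ A * (m / A) := mul_le_mul_of_nonneg_left (hη.trans (min_le_right _ _)) A0.le
      _ = m := by field_simp
  have hsB := abs_le.1 (hs.trans (le_abs_self B))
  have mem : ∀ x, |x - s| ≤ 1 → x ∈ I := by
    intro x hx
    have := abs_le.1 hx
    constructor <;> linarith
  have msI : s ∈ I := mem s (by simp)
  have mhI : h ∈ I := mem h (hh.trans hη1)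
  have ahs : |M.a h - M.a s| ≤ A * η :=
    ((convex_Icc _ _).norm_image_sub_le_of_norm_deriv_le (f := M.a) (C := A)
      (fun x _ => M.differentiable_a x) (fun x hx => hx₁ hx) msI mhI).trans
      (mul_le_mul_of_nonneg_left hh A0.le)
  have grow : ∀ x ∈ I, ∀ y ∈ I, x ≤ y → m * (y - x) ≤ σ * M.a y - σ * M.a x := by
    apply (convex_Icc _ _).mul_sub_le_image_sub_of_le_deriv (f := fun x => σ * M.a x)
    · exact (continuous_const.mul M.continuous_a).continuousOn
    · exact (M.differentiable_a.const_mul σ).differentiableOn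
    · intro x hx
      rw [deriv_const_mul_field, hd]
      exact hx₀ (interior_subset hx)
  have g₁ := grow (s - ρ) (mem _ (by rw [abs_le]; constructor <;> linarith)) s msI (by linarith)
  have g₂ := grow s msI (s + ρ) (mem _ (by rw [abs_le]; constructor <;> linarith)) (by linarith)
  have mρ : m * ρ = A * η := by rw [hρ]; field_simp
  have σa : |σ * (M.a h - M.a s)| ≤ A * η := by
    rw [abs_mul]
    rcases hσ with rfl | rfl <;> simpa using ahs
  -- The quotient f(y, s)²/f(y, h) has natural parameter 2a(s) - a(h). It is attained near s because
  -- |a'| ≥ m lets σa change by at least Aη on each side of s.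
  obtain ⟨h', hh', hah'⟩ : σ * (2 * M.a s - M.a h) ∈ (fun x => σ * M.a x) '' Set.Icc (s - ρ) (s + ρ) := by
    apply intermediate_value_Icc (by linarith) (continuous_const.mul M.continuous_a).continuousOn
    have := abs_le.1 σa
    constructor <;> simp only [Pi.mul_apply] <;> linarith
  have hah : M.a h' = 2 * M.a s - M.a h := by
    rcases hσ with rfl | rfl <;> simp only at hah' <;> linarith
  have dh' : |h' - s| ≤ ρ := by rw [abs_le]; constructor <;> linarith [hh'.1, hh'.2]
  have mh' : h' ∈ I := mem h' (dh'.trans hρ1)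
  have e : ∀ y, M.f y s / M.f y h * M.f y s =
      Real.exp (M.a h' * y + (2 * M.b s - M.b h) + M.c y) := by
    intro y
    rw [GLM.f, GLM.f, ← Real.exp_sub, ← Real.exp_add, hah]
    congr 1
    ring
  simp_rw [e]
  rw [lintegral_exp]
  apply ENNReal.ofReal_le_ofReal
  apply Real.exp_le_exp.2
  have b₁ := (abs_le.1 (M.abs_b_sub_le mhI msI)).1
  have b₂ := (abs_le.1 (M.abs_b_sub_le mh' msI)).1
  have c₁ := mul_le_mul_of_nonneg_left hh S0
  have c₂ := mul_le_mul_of_nonneg_left dh' S0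
  have : (M.slope (|B| + 1) + 1) * (1 + A / m) * η =
      M.slope (|B| + 1) * η + M.slope (|B| + 1) * ρ + (η + ρ) := by rw [hρ]; ring
  rw [this]
  linarith

end GLM

/-! ### Evidence and posterior bounds for an abstract likelihood ratio. -/

section Abstract

variable {X Θ : Type*} [MeasurableSpace X] [MeasurableSpace Θ]

lemma lintegral_pi_prod (P : Measure X) [IsProbabilityMeasure P] (n : ℕ) {g : X → ℝ≥0∞}
    (hg : Measurable g) :
    ∫⁻ x : Fin n → X, ∏ i, g (x i) ∂(Measure.pi fun _ => P) = (∫⁻ x, g x ∂P) ^ n := by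
  have hind : iIndepFun (fun (i : Fin n) (x : Fin n → X) => g (x i)) (Measure.pi fun _ => P) :=
    iIndepFun_pi (X := fun _ => g) fun _ => hg.aemeasurable
  rw [lintegral_prod_eq_prod_lintegral_of_indepFun Finset.univ _ hind (fun i => by fun_prop)]
  have : ∀ i : Fin n, ∫⁻ x : Fin n → X, g (x i) ∂(Measure.pi fun _ => P) = ∫⁻ x, g x ∂P := by
    intro i
    rw [← lintegral_map hg (measurable_pi_apply i), (measurePreserving_eval (fun _ => P) i).map_eq]
  simp [this]

lemma two_le_div_add_div {r m : ℝ≥0∞} (hm : m ≠ 0) (hm' : m ≠ ∞) (hr : r ≠ 0) (hr' : r ≠ ∞) :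
    2 ≤ r / m + m / r := by
  lift r to NNReal using hr'
  lift m to NNReal using hm'
  have hm : m ≠ 0 := by exact_mod_cast hm
  have hr : r ≠ 0 := by exact_mod_cast hr
  rw [← ENNReal.coe_div hm, ← ENNReal.coe_div hr]
  norm_cast
  rw [← NNReal.coe_le_coe]
  push_cast
  have hm : (0 : ℝ) < m := NNReal.coe_pos.2 (pos_iff_ne_zero.2 hm)
  have hr : (0 : ℝ) < r := NNReal.coe_pos.2 (pos_iff_ne_zero.2 hr)
  rw [div_add_div _ _ hm.ne' hr.ne', le_div_iff₀ (by positivity)]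
  nlinarith [sq_nonneg ((r : ℝ) - m)]

variable {P : Measure X} [IsProbabilityMeasure P] {π : Measure Θ} [IsProbabilityMeasure π]
  {ℓ : X → Θ → ℝ≥0∞} {n : ℕ}

/-- Lower bound for the evidence, where `ℓ x θ` is a likelihood ratio. -/
lemma evidence_lower_bound (hℓ : Measurable (Function.uncurry ℓ)) (hℓ0 : ∀ x θ, ℓ x θ ≠ 0)
    (hℓ' : ∀ x θ, ℓ x θ ≠ ∞) {G : Set Θ} (hG0 : π G ≠ 0)
    {A m : ℝ≥0∞} (hm0 : m ≠ 0) (hm : m ≠ ∞) (hA : ∀ θ ∈ G, ∫⁻ x, (ℓ x θ)⁻¹ ∂P ≤ A) :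
    (Measure.pi fun _ : Fin n => P) {x | ∫⁻ θ, ∏ i, ℓ (x i) θ ∂π < m * π G} ≤ m * A ^ n := by
  have hGt : π G ≠ ∞ := measure_ne_top π G
  set W : (Fin n → X) → ℝ≥0∞ := fun x => ∫⁻ θ in G, ∏ i, (ℓ (x i) θ)⁻¹ ∂π with hW
  have hprod : Measurable (Function.uncurry fun (x : Fin n → X) θ => ∏ i, (ℓ (x i) θ)⁻¹) := by
    apply Finset.measurable_prod
    intro i _
    exact (hℓ.comp (by fun_prop : Measurable fun p : (Fin n → X) × Θ => (p.1 i, p.2))).inv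
  have hWm : Measurable W := hprod.lintegral_prod_right
  -- When the evidence is below m π(G), the term L/m integrates over G to at most π(G), so the other
  -- term must supply the rest of 2 π(G).
  have key : ∀ x : Fin n → X, ∫⁻ θ, ∏ i, ℓ (x i) θ ∂π < m * π G → π G ≤ m * W x := by
    intro x hx
    have hxm : Measurable fun θ => ∏ i, ℓ (x i) θ := by
      apply Finset.measurable_prod
      intro i _
      exact hℓ.comp (measurable_const.prodMk measurable_id)
    have hxi : Measurable fun θ => ∏ i, (ℓ (x i) θ)⁻¹ :=
      hprod.comp (measurable_const.prodMk measurable_id)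
    have h1 : ∫⁻ _ in G, 2 ∂π ≤
        ∫⁻ θ in G, (m⁻¹ * ∏ i, ℓ (x i) θ + m * ∏ i, (ℓ (x i) θ)⁻¹) ∂π := by
      apply lintegral_mono
      intro θ
      have := two_le_div_add_div hm0 hm (r := ∏ i, ℓ (x i) θ)
        (Finset.prod_ne_zero_iff.2 fun i _ => hℓ0 _ _) (ENNReal.prod_ne_top fun i _ => hℓ' _ _)
      dsimp only
      rw [← ENNReal.prod_inv_distrib (fun i _ j _ _ => Or.inr (hℓ' _ _)), mul_comm m⁻¹]
      exact this
    rw [lintegral_add_left (by fun_prop), lintegral_const_mul _ hxm, lintegral_const_mul _ hxi,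
      setLIntegral_const] at h1
    have h2 : m⁻¹ * ∫⁻ θ in G, ∏ i, ℓ (x i) θ ∂π ≤ π G := by
      calc _ ≤ m⁻¹ * (m * π G) := by
            gcongr; exact (setLIntegral_le_lintegral _ _).trans hx.le
        _ = π G := by rw [← mul_assoc, ENNReal.inv_mul_cancel hm0 hm, one_mul]
    rw [two_mul] at h1
    exact (ENNReal.add_le_add_iff_left hGt).1 (h1.trans (by gcongr))
  calc _ ≤ (Measure.pi fun _ : Fin n => P) {x | π G / m ≤ W x} := by
        apply measure_mono
        intro x hx
        exact ENNReal.div_le_of_le_mul' (key x hx)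
    _ ≤ (∫⁻ x, W x ∂(Measure.pi fun _ : Fin n => P)) / (π G / m) :=
        meas_ge_le_lintegral_div hWm.aemeasurable (ENNReal.div_ne_zero.2 ⟨hG0, hm⟩)
          (ENNReal.div_ne_top hGt hm0)
    _ ≤ (A ^ n * π G) / (π G / m) := by
        gcongr
        rw [hW, lintegral_lintegral_swap hprod.aemeasurable, ← setLIntegral_const]
        apply setLIntegral_mono measurable_const
        intro θ hθ
        rw [lintegral_pi_prod P n (g := fun x => (ℓ x θ)⁻¹)
          (hℓ.comp (measurable_id.prodMk measurable_const)).inv]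
        gcongr
        exact hA θ hθ
    _ = m * A ^ n := by
        rw [div_eq_mul_inv, ENNReal.inv_div (Or.inl hm) (Or.inl hm0), mul_comm, div_eq_mul_inv,
          mul_assoc, mul_comm (A ^ n), ← mul_assoc _ (π G), ENNReal.inv_mul_cancel hG0 hGt, one_mul]

/-- This replaces tests: a posterior probability bounded by a product of ratios is also bounded by
the product of their square roots, whose expectation is a power of an affinity. -/
lemma le_rpow_half_of_le {x a : ℝ≥0∞} (h1 : x ≤ 1) (h : x ≤ a) : x ≤ a ^ (1 / 2 : ℝ) := by
  calc x = x ^ (1 : ℝ) := (ENNReal.rpow_one x).symm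
    _ ≤ x ^ (1 / 2 : ℝ) := ENNReal.rpow_le_rpow_of_exponent_ge h1 (by norm_num)
    _ ≤ _ := ENNReal.rpow_le_rpow h (by norm_num)

/-- The posterior mass of a set that is covered, up to a small set `S`, by finitely many cells
`C j`, each with an upper envelope `F j` of small affinity, has a measurable majorant of small
expectation. -/
lemma exists_posterior_majorant (hℓ : Measurable (Function.uncurry ℓ))
    (hℓ0 : ∀ x θ, ℓ x θ ≠ 0) (hℓ' : ∀ x θ, ℓ x θ ≠ ∞)
    (hℓ1 : ∀ θ, ∫⁻ x, ℓ x θ ∂P ≤ 1)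
    {G : Set Θ} (hG0 : π G ≠ 0)
    {A m ρ : ℝ≥0∞} (hm0 : m ≠ 0) (hm : m ≠ ∞) (hA : ∀ θ ∈ G, ∫⁻ x, (ℓ x θ)⁻¹ ∂P ≤ A)
    {ι : Type*} (J : Finset ι) (C : ι → Set Θ) (S B : Set Θ)
    (hB : B ⊆ (⋃ j ∈ J, C j) ∪ S)
    (F : ι → X → ℝ≥0∞) (hF : ∀ j ∈ J, Measurable (F j))
    (hCF : ∀ j ∈ J, ∀ᵐ x ∂P, ∀ θ ∈ C j, ℓ x θ ≤ F j x)
    (hFρ : ∀ j ∈ J, ∫⁻ x, (F j x) ^ (1 / 2 : ℝ) ∂P ≤ ρ) :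
    ∃ g : (Fin n → X) → ℝ≥0∞, Measurable g ∧
      (∀ᵐ x ∂(Measure.pi fun _ : Fin n => P), (∫⁻ θ, ∏ i, ℓ (x i) θ ∂π)⁻¹ *
        ∫⁻ θ in B, ∏ i, ℓ (x i) θ ∂π ≤ g x) ∧
      ∫⁻ x, g x ∂(Measure.pi fun _ : Fin n => P) ≤
        m * A ^ n + (J.card * ((m * π G)⁻¹ ^ (1 / 2 : ℝ) * ρ ^ n) + (m * π G)⁻¹ * π S) := by
  set Pn := Measure.pi fun _ : Fin n => P
  set T := (m * π G)⁻¹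
  set Z : (Fin n → X) → ℝ≥0∞ := fun x => ∫⁻ θ, ∏ i, ℓ (x i) θ ∂π with hZ
  set E : Set (Fin n → X) := {x | Z x < m * π G}
  have hprod : Measurable (Function.uncurry fun (x : Fin n → X) θ => ∏ i, ℓ (x i) θ) := by
    apply Finset.measurable_prod
    intro i _
    exact hℓ.comp (by fun_prop : Measurable fun p : (Fin n → X) × Θ => (p.1 i, p.2))
  have hZm : Measurable Z := hprod.lintegral_prod_right
  have hE : MeasurableSet E := measurableSet_lt hZm measurable_const
  have hSm : Measurable fun x : Fin n → X => ∫⁻ θ in S, ∏ i, ℓ (x i) θ ∂π :=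
    hprod.lintegral_prod_right
  have hFm : ∀ j ∈ J, Measurable fun x : Fin n → X => ∏ i, (F j (x i)) ^ (1 / 2 : ℝ) := by
    intro j hj
    apply Finset.measurable_prod
    intro i _
    exact ((hF j hj).comp (measurable_pi_apply i)).pow_const _
  have hsum : Measurable fun x : Fin n → X =>
      ∑ j ∈ J, T ^ (1 / 2 : ℝ) * ∏ i, (F j (x i)) ^ (1 / 2 : ℝ) :=
    Finset.measurable_sum _ fun j hj => (hFm j hj).const_mul _
  -- The three terms pay for small evidence, for the cells, and for the part off the sieve. Working
  -- with a measurable majorant avoids any measurability requirement on the target set or the cells.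
  refine ⟨fun x => E.indicator 1 x + (∑ j ∈ J, T ^ (1 / 2 : ℝ) * ∏ i, (F j (x i)) ^ (1 / 2 : ℝ) +
    T * ∫⁻ θ in S, ∏ i, ℓ (x i) θ ∂π), ?_, ?_, ?_⟩
  · exact (measurable_one.indicator hE).add (hsum.add (hSm.const_mul _))
  · have hae : ∀ᵐ x ∂Pn, ∀ j ∈ J, ∀ i, ∀ θ ∈ C j, ℓ (x i) θ ≤ F j (x i) := by
      refine (Filter.eventually_all_finset J).2 fun j hj => ?_
      rw [ae_all_iff]
      intro i
      exact (Measure.tendsto_eval_ae_ae (μ := fun _ => P) (i := i)).eventually (hCF j hj)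
    filter_upwards [hae] with x hx
    have le_one : ∀ D : Set Θ, (Z x)⁻¹ * ∫⁻ θ in D, ∏ i, ℓ (x i) θ ∂π ≤ 1 := by
      intro D
      calc _ ≤ (Z x)⁻¹ * Z x := by gcongr; exact setLIntegral_le_lintegral _ _
        _ ≤ 1 := ENNReal.inv_mul_le_one _
    by_cases hxE : x ∈ E
    · calc _ ≤ 1 := le_one B
        _ ≤ _ := by simp [hxE]
    · have hZT : (Z x)⁻¹ ≤ T := ENNReal.inv_le_inv.2 (not_lt.1 hxE)
      have hcell : ∀ j ∈ J, (Z x)⁻¹ * ∫⁻ θ in C j, ∏ i, ℓ (x i) θ ∂π ≤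
          T ^ (1 / 2 : ℝ) * ∏ i, (F j (x i)) ^ (1 / 2 : ℝ) := by
        intro j hj
        have hle : (Z x)⁻¹ * ∫⁻ θ in C j, ∏ i, ℓ (x i) θ ∂π ≤ T * ∏ i, F j (x i) := by
          gcongr
          calc _ ≤ ∫⁻ θ in C j, ∏ i, F j (x i) ∂π := by
                apply setLIntegral_mono measurable_const
                intro θ hθ
                exact Finset.prod_le_prod' fun i _ => hx j hj i θ hθ
            _ = (∏ i, F j (x i)) * π (C j) := setLIntegral_const _ _
            _ ≤ (∏ i, F j (x i)) * 1 := by gcongr; exact prob_le_one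
            _ = _ := mul_one _
        have := le_rpow_half_of_le (le_one (C j)) hle
        rwa [ENNReal.mul_rpow_of_nonneg _ _ (by norm_num),
          ← ENNReal.prod_rpow_of_nonneg (by norm_num)] at this
      calc _ ≤ (Z x)⁻¹ * (∑ j ∈ J, ∫⁻ θ in C j, ∏ i, ℓ (x i) θ ∂π +
            ∫⁻ θ in S, ∏ i, ℓ (x i) θ ∂π) := by
            gcongr
            calc _ ≤ ∫⁻ θ in (⋃ j ∈ J, C j) ∪ S, ∏ i, ℓ (x i) θ ∂π := lintegral_mono_set hB
              _ ≤ ∫⁻ θ in ⋃ j ∈ J, C j, ∏ i, ℓ (x i) θ ∂π + _ := lintegral_union_le _ _ _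
              _ ≤ _ := by
                gcongr
                rw [← Finset.sum_coe_sort, ← tsum_fintype (L := SummationFilter.unconditional _),
                  ← Set.iUnion_subtype (p := fun j => j ∈ J) (s := fun j => C j)]
                exact lintegral_iUnion_le (fun j : {j // j ∈ J} => C j) _
        _ = ∑ j ∈ J, (Z x)⁻¹ * ∫⁻ θ in C j, ∏ i, ℓ (x i) θ ∂π +
            (Z x)⁻¹ * ∫⁻ θ in S, ∏ i, ℓ (x i) θ ∂π := by rw [mul_add, Finset.mul_sum]
        _ ≤ ∑ j ∈ J, T ^ (1 / 2 : ℝ) * ∏ i, (F j (x i)) ^ (1 / 2 : ℝ) +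
            T * ∫⁻ θ in S, ∏ i, ℓ (x i) θ ∂π := by
            exact add_le_add (Finset.sum_le_sum hcell) (by gcongr)
        _ ≤ _ := le_add_self
  · rw [lintegral_add_left (measurable_one.indicator hE), lintegral_add_left hsum,
      lintegral_indicator_one hE, lintegral_finsetSum' _ (fun j hj => ((hFm j hj).const_mul _).aemeasurable),
      lintegral_const_mul _ hSm]
    gcongr
    · exact evidence_lower_bound hℓ hℓ0 hℓ' hG0 hm0 hm hA
    · rw [← nsmul_eq_mul]
      apply Finset.sum_le_card_nsmul
      intro j hj
      rw [lintegral_const_mul _ (hFm j hj), lintegral_pi_prod P n ((hF j hj).pow_const _)]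
      gcongr
      exact hFρ j hj
    · rw [lintegral_lintegral_swap hprod.aemeasurable]
      -- After exchanging integrals, a likelihood ratio has expectation at most 1 under the truth,
      -- so only the prior mass of `S` remains.
      calc _ ≤ ∫⁻ _ in S, 1 ∂π := by
            apply lintegral_mono
            intro θ
            dsimp only
            rw [lintegral_pi_prod P n (g := fun x => ℓ x θ)
              (hℓ.comp (measurable_id.prodMk measurable_const))]
            exact pow_le_one₀ zero_le (hℓ1 θ)
        _ = π S := by simp

end Abstract

/-! ### Largest eigenvalue and square roots of positive definite matrices. -/

section PosDef

open Matrix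
open scoped MatrixOrder

variable {ι : Type*} [Fintype ι] [DecidableEq ι]

lemma le_ch₁ {W : Matrix ι ι ℝ} {x : ℝ} (hx : x ∈ spectrum ℝ W) : x ≤ ch₁ W :=
  le_csSup W.finite_real_spectrum.bddAbove hx

lemma dotProduct_mulVec_le_ch₁ {W : Matrix ι ι ℝ} (hW : W.PosDef) (w : ι → ℝ) :
    w ⬝ᵥ W *ᵥ w ≤ ch₁ W * (w ⬝ᵥ w) := by
  have h : W ≤ algebraMap ℝ (Matrix ι ι ℝ) (ch₁ W) :=
    le_algebraMap_of_spectrum_le (fun x hx => le_ch₁ hx) hW.isHermitian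
  rw [Matrix.le_iff] at h
  have := h.dotProduct_mulVec_nonneg w
  simp [Algebra.algebraMap_eq_smul_one, sub_mulVec, smul_mulVec] at this
  exact this

lemma diag_le_ch₁ {W : Matrix ι ι ℝ} (hW : W.PosDef) (i : ι) : W i i ≤ ch₁ W := by
  have := dotProduct_mulVec_le_ch₁ hW (Pi.single i 1)
  simpa using this

lemma norm_sqrt_apply_sq_le {W : Matrix ι ι ℝ} (hW : W.PosDef) (w : EuclideanSpace ℝ ι) :
    ‖toEuclideanCLM (𝕜 := ℝ) (CFC.sqrt W) w‖ ^ 2 ≤ ch₁ W * ‖w‖ ^ 2 := by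
  have sa : IsSelfAdjoint (toEuclideanCLM (𝕜 := ℝ) (CFC.sqrt W)) :=
    (CFC.sqrt_nonneg W).isSelfAdjoint.map _
  rw [← real_inner_self_eq_norm_sq, ← ContinuousLinearMap.adjoint_inner_left, sa.adjoint_eq,
    ← ContinuousLinearMap.comp_apply, ← ContinuousLinearMap.mul_def, ← map_mul,
    CFC.sqrt_mul_sqrt_self _ hW.posSemidef.nonneg, real_inner_comm, inner_toEuclideanCLM]
  refine (dotProduct_mulVec_le_ch₁ hW _).trans_eq ?_
  rw [EuclideanSpace.real_norm_sq_eq, dotProduct]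
  simp_rw [← sq]

end PosDef

/-! ### Gaussian tails and small-cube probabilities. -/

section Gaussian

open Matrix
open scoped MatrixOrder NNReal

/-- Chernoff's bound on each side, with exponents ±C/v₀ optimal for the upper bound v₀ on the
variance. -/
lemma gaussianReal_tail_le {v : ℝ≥0} {v₀ C : ℝ} (hv : v ≤ v₀) (hv₀ : 0 < v₀) (hC : 0 ≤ C) :
    gaussianReal 0 v {x | C < |x|} ≤ ENNReal.ofReal (2 * Real.exp (-(C ^ 2 / (2 * v₀)))) := by
  have bound : ∀ t : ℝ, |t| = C / v₀ →
      Real.exp (-|t| * C) * mgf id (gaussianReal 0 v) t ≤ Real.exp (-(C ^ 2 / (2 * v₀))) := by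
    intro t ht
    rw [mgf_id_gaussianReal, ← Real.exp_add]
    apply Real.exp_le_exp.2
    have : (v : ℝ) * t ^ 2 ≤ v₀ * t ^ 2 := mul_le_mul_of_nonneg_right hv (sq_nonneg t)
    rw [← sq_abs, ht] at this
    rw [← sq_abs t, ht]
    have e : -(C / v₀) * C + v₀ * (C / v₀) ^ 2 / 2 = -(C ^ 2 / (2 * v₀)) := by field_simp; ring
    linarith
  have ht : 0 ≤ C / v₀ := by positivity
  have h₁ := measure_ge_le_exp_mul_mgf (μ := gaussianReal 0 v) (X := id) C ht
    (integrable_exp_mul_gaussianReal _)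
  have h₂ := measure_le_le_exp_mul_mgf (μ := gaussianReal 0 v) (X := id) (-C)
    (neg_nonpos.2 ht) (integrable_exp_mul_gaussianReal _)
  have b₁ := bound (C / v₀) (abs_of_nonneg ht)
  have b₂ := bound (-(C / v₀)) (by rw [abs_neg, abs_of_nonneg ht])
  rw [abs_of_nonneg ht] at b₁
  rw [abs_neg, abs_of_nonneg ht] at b₂
  rw [neg_neg, mul_neg, ← neg_mul] at h₂
  calc gaussianReal 0 v {x | C < |x|}
      ≤ gaussianReal 0 v ({x | C ≤ id x} ∪ {x | id x ≤ -C}) := by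
        apply measure_mono
        intro x hx
        rcases lt_abs.1 (show C < |x| from hx) with h | h
        · exact Or.inl h.le
        · exact Or.inr (by simp only [Set.mem_ofPred_eq, id]; linarith)
    _ ≤ _ := measure_union_le _ _
    _ ≤ ENNReal.ofReal (Real.exp (-(C ^ 2 / (2 * v₀)))) +
        ENNReal.ofReal (Real.exp (-(C ^ 2 / (2 * v₀)))) := by
        rw [← ofReal_measureReal (measure_ne_top _ _), ← ofReal_measureReal (measure_ne_top _ _)]
        exact add_le_add (ENNReal.ofReal_le_ofReal (h₁.trans b₁))
          (ENNReal.ofReal_le_ofReal (h₂.trans b₂))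
    _ = _ := by
        rw [← ENNReal.ofReal_add (Real.exp_pos _).le (Real.exp_pos _).le]
        congr 1
        ring

/-- Within distance 1 of u one has x²/2 ≤ u² + 1. The bounds √(2π) ≤ 3 and 1/e ≤ 1/2 then give the
density lower bound exp(-u² - 2)/2 on an interval of length 2t. -/
lemma le_gaussianReal_closedBall {t u : ℝ} (ht1 : t ≤ 1) :
    ENNReal.ofReal (t * Real.exp (-u ^ 2 - 2)) ≤ gaussianReal 0 1 {x | |x - u| ≤ t} := by
  have hset : {x : ℝ | |x - u| ≤ t} = Set.Icc (u - t) (u + t) := by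
    ext x
    simp only [Set.mem_ofPred_eq, Set.mem_Icc, abs_le]
    constructor <;> rintro ⟨h1, h2⟩ <;> constructor <;> linarith
  have hlow : ∀ x ∈ Set.Icc (u - t) (u + t),
      ENNReal.ofReal (Real.exp (-u ^ 2 - 2) / 2) ≤ gaussianPDF 0 1 x := by
    intro x hx
    rw [gaussianPDF, gaussianPDFReal]
    apply ENNReal.ofReal_le_ofReal
    have hsq : √(2 * Real.pi * (1 : ℝ≥0)) ≤ 3 := by
      rw [Real.sqrt_le_left (by norm_num)]
      have := Real.pi_lt_d2
      push_cast
      linarith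
    have hpos : 0 < √(2 * Real.pi * (1 : ℝ≥0)) := by
      have := Real.pi_pos
      positivity
    have h3 : (3 : ℝ)⁻¹ ≤ (√(2 * Real.pi * (1 : ℝ≥0)))⁻¹ := inv_anti₀ hpos hsq
    have hx2 : -u ^ 2 - 1 ≤ -(x - 0) ^ 2 / (2 * ((1 : ℝ≥0) : ℝ)) := by
      have : |x - u| ≤ 1 := (abs_le.2 ⟨by linarith [hx.1], by linarith [hx.2]⟩ : |x - u| ≤ t).trans ht1
      have : (x - u) ^ 2 ≤ 1 := by rw [← sq_abs]; exact pow_le_one₀ (abs_nonneg _) this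
      push_cast
      nlinarith [sq_nonneg (x - 2 * u)]
    have he : Real.exp (-u ^ 2 - 2) = Real.exp (-u ^ 2 - 1) * Real.exp (-1) := by
      rw [← Real.exp_add]; congr 1; ring
    have he1 : Real.exp (-1) ≤ 1 / 2 := by
      rw [Real.exp_neg, inv_le_comm₀ (Real.exp_pos _) (by norm_num)]
      linarith [Real.add_one_le_exp (1 : ℝ)]
    calc Real.exp (-u ^ 2 - 2) / 2 ≤ 3⁻¹ * Real.exp (-u ^ 2 - 1) := by
          rw [he]; nlinarith [Real.exp_pos (-u ^ 2 - 1)]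
      _ ≤ _ := by gcongr
  rw [hset, gaussianReal_apply 0 one_ne_zero]
  calc ENNReal.ofReal (t * Real.exp (-u ^ 2 - 2))
      = ENNReal.ofReal (Real.exp (-u ^ 2 - 2) / 2) * volume (Set.Icc (u - t) (u + t)) := by
        rw [Real.volume_Icc, ← ENNReal.ofReal_mul (by positivity)]
        congr 1
        ring
    _ = ∫⁻ _ in Set.Icc (u - t) (u + t), ENNReal.ofReal (Real.exp (-u ^ 2 - 2) / 2) :=
        (setLIntegral_const _ _).symm
    _ ≤ _ := setLIntegral_mono (measurable_gaussianPDF 0 1) hlow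

variable {ι : Type*} [Fintype ι]

lemma le_stdGaussian_cube {t : ℝ} (ht : 0 ≤ t) (ht1 : t ≤ 1) (u : EuclideanSpace ℝ ι) :
    ENNReal.ofReal (t ^ Fintype.card ι * Real.exp (-‖u‖ ^ 2 - 2 * Fintype.card ι)) ≤
      stdGaussian (EuclideanSpace ℝ ι) {z | ∀ j, |z j - u j| ≤ t} := by
  have hm : MeasurableSet {z : EuclideanSpace ℝ ι | ∀ j, |z j - u j| ≤ t} := by
    simp only [Set.ofPred_forall]
    exact MeasurableSet.iInter fun j => measurableSet_le (by fun_prop) measurable_const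
  rw [← map_pi_eq_stdGaussian, Measure.map_apply (by fun_prop) hm]
  have hset : (WithLp.toLp 2) ⁻¹' {z : EuclideanSpace ℝ ι | ∀ j, |z j - u j| ≤ t} =
      Set.univ.pi fun j => {x : ℝ | |x - u j| ≤ t} := by
    ext x
    simp
  rw [hset, Measure.pi_pi]
  calc _ = ∏ j, ENNReal.ofReal (t * Real.exp (-(u j) ^ 2 - 2)) := by
        rw [← ENNReal.ofReal_prod_of_nonneg (fun j _ => by positivity), Finset.prod_mul_distrib,
          ← Real.exp_sum]
        congr 2
        · simp
        · rw [EuclideanSpace.real_norm_sq_eq]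
          congr 1
          simp [Finset.sum_sub_distrib, mul_comm]
    _ ≤ _ := Finset.prod_le_prod' fun j _ => le_gaussianReal_closedBall ht1

variable [DecidableEq ι]

/-- A lower bound for the mass of a small cube under a centred Gaussian law. -/
lemma le_multivariateGaussian_cube {V : Matrix ι ι ℝ} (hV : V.PosDef) (β : EuclideanSpace ℝ ι)
    {t η b B : ℝ} (ht : 0 ≤ t) (ht1 : t ≤ 1) (hη : 0 ≤ η) (hb : ch₁ V ≤ b) (hB : ch₁ V⁻¹ ≤ B)
    (htη : b * (Fintype.card ι * t ^ 2) ≤ η ^ 2) :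
    ENNReal.ofReal (t ^ Fintype.card ι * Real.exp (-(B * ‖β‖ ^ 2) - 2 * Fintype.card ι)) ≤
      multivariateGaussian 0 V {v | ∀ j, |v j - β j| ≤ η} := by
  have hm : MeasurableSet {v : EuclideanSpace ℝ ι | ∀ j, |v j - β j| ≤ η} := by
    simp only [Set.ofPred_forall]
    exact MeasurableSet.iInter fun j => measurableSet_le (by fun_prop) measurable_const
  set A := toEuclideanCLM (𝕜 := ℝ) (CFC.sqrt V) with hA
  -- The law is the image of the standard Gaussian under √V, so the cube is pulled back to a
  -- neighbourhood of u = V^(-1/2) β. The t-cube about u is mapped inside the η-cube about β, since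
  -- √V stretches squared lengths by at most ch₁ V.
  set u := toEuclideanCLM (𝕜 := ℝ) (CFC.sqrt V⁻¹) β with hu
  have hu2 : ‖u‖ ^ 2 ≤ B * ‖β‖ ^ 2 :=
    (norm_sqrt_apply_sq_le hV.inv β).trans (mul_le_mul_of_nonneg_right hB (sq_nonneg _))
  have hunit : IsUnit (CFC.sqrt V).det := by
    have h2 : IsUnit (CFC.sqrt V * CFC.sqrt V).det := by
      rw [CFC.sqrt_mul_sqrt_self _ hV.posSemidef.nonneg]
      exact (Matrix.isUnit_iff_isUnit_det _).1 hV.isUnit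
    rw [Matrix.det_mul] at h2
    exact isUnit_of_mul_isUnit_left h2
  have hAu : A u = β := by
    rw [hA, hu, ← hV.posSemidef.inv_sqrt, ← ContinuousLinearMap.comp_apply,
      ← ContinuousLinearMap.mul_def, ← map_mul, Matrix.mul_nonsing_inv _ hunit, map_one]
    rfl
  rw [multivariateGaussian, Measure.map_apply (by fun_prop) hm]
  calc _ ≤ ENNReal.ofReal (t ^ Fintype.card ι * Real.exp (-‖u‖ ^ 2 - 2 * Fintype.card ι)) := by
        apply ENNReal.ofReal_le_ofReal
        gcongr
    _ ≤ _ := le_stdGaussian_cube ht ht1 u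
    _ ≤ _ := by
        apply measure_mono
        intro z hz j
        have e : (0 + A z) j - β j = (A (z - u)) j := by
          rw [map_sub, hAu, zero_add]; rfl
        rw [e]
        apply abs_le_of_sq_le_sq _ hη
        have hn : ‖z - u‖ ^ 2 ≤ Fintype.card ι * t ^ 2 := by
          rw [EuclideanSpace.real_norm_sq_eq]
          calc _ ≤ ∑ _j : ι, t ^ 2 := by
                apply Finset.sum_le_sum
                intro i _
                rw [← sq_abs]
                exact pow_le_pow_left₀ (abs_nonneg _) (hz i) 2
            _ = _ := by simp
        have hb0 : 0 ≤ b := by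
          refine le_trans ?_ ((diag_le_ch₁ hV j).trans hb)
          exact hV.diag_pos.le
        calc (A (z - u)) j ^ 2 ≤ ‖A (z - u)‖ ^ 2 := by
              rw [← sq_abs]
              exact pow_le_pow_left₀ (abs_nonneg _) (PiLp.norm_apply_le (A (z - u)) j) 2
          _ ≤ ch₁ V * ‖z - u‖ ^ 2 := norm_sqrt_apply_sq_le hV _
          _ ≤ b * (Fintype.card ι * t ^ 2) := by gcongr
          _ ≤ η ^ 2 := htη

/-- The coordinate is a centred Gaussian of variance V j j, and a diagonal entry is at most the
largest eigenvalue. -/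
lemma multivariateGaussian_coord_tail_le {V : Matrix ι ι ℝ} (hV : V.PosDef) (j : ι) {b C : ℝ}
    (hb : ch₁ V ≤ b) (hC : 0 ≤ C) :
    multivariateGaussian 0 V {v | C < |v j|} ≤
      ENNReal.ofReal (2 * Real.exp (-(C ^ 2 / (2 * b)))) := by
  have hmp := measurePreserving_eval_multivariateGaussian (μ := 0) hV.posSemidef (i := j)
  have hm : MeasurableSet {x : ℝ | C < |x|} := measurableSet_lt measurable_const (by fun_prop)
  have hpos : 0 < V j j := hV.diag_pos
  have hle : V j j ≤ b := (diag_le_ch₁ hV j).trans hb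
  have := hmp.measure_preimage hm.nullMeasurableSet
  rw [Set.preimage_ofPred_eq] at this
  rw [this]
  exact gaussianReal_tail_le (by rw [Real.coe_toNNReal _ hpos.le]; exact hle) (hpos.trans_le hle) hC

end Gaussian

/-! ### Measurability on disjoint unions. -/

section Sigma

variable {ι : Type*} {E : ι → Type*} [∀ i, MeasurableSpace (E i)]

lemma measurableSet_sigma {s : Set (Σ i, E i)}
    (h : ∀ i, MeasurableSet (Sigma.mk i ⁻¹' s)) : MeasurableSet s :=
  MeasurableSpace.measurableSet_iInf.2 h

lemma measurable_sigma {α : Type*} [MeasurableSpace α] {g : (Σ i, E i) → α}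
    (h : ∀ i, Measurable fun v : E i => g ⟨i, v⟩) : Measurable g :=
  fun _ hs => measurableSet_sigma fun i => h i hs

lemma measurable_sigmaMk' (i : ι) : Measurable (Sigma.mk i : E i → Σ i, E i) :=
  fun _ hs => MeasurableSpace.measurableSet_iInf.1 hs i

end Sigma

/-! ### Parameters as coefficient vectors in ℝ^K, and linear predictors. -/

section Coefficients

variable {K : ℕ}

/-- The coefficient vector in `ℝ^K` of a parameter, zero outside the model. -/
def coef (θ : Param K) (j : Fin K) : ℝ := if h : j ∈ θ.1 then θ.2 ⟨j, h⟩ else 0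

lemma coef_mk_coe (γ : Finset (Fin K)) (v : EuclideanSpace ℝ γ) (j : γ) :
    coef ⟨γ, v⟩ j = v j := by
  simp [coef]

lemma coef_of_notMem {θ : Param K} {j : Fin K} (h : j ∉ θ.1) : coef θ j = 0 := by
  simp [coef, h]

lemma measurable_paramMk (γ : Finset (Fin K)) :
    Measurable fun v : EuclideanSpace ℝ γ => (⟨γ, v⟩ : Param K) :=
  measurable_sigmaMk' (E := fun γ : Finset (Fin K) => EuclideanSpace ℝ γ) γ

@[fun_prop]
lemma measurable_coef (j : Fin K) : Measurable fun θ : Param K => coef θ j := by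
  apply measurable_sigma
  intro γ
  by_cases h : j ∈ γ
  · simp only [coef, h, dif_pos]
    exact (EuclideanSpace.proj (𝕜 := ℝ) (⟨j, h⟩ : γ)).continuous.measurable
  · simp only [coef, h, dif_neg, not_false_eq_true]
    fun_prop

/-- The linear predictor `x_γᵀ β_γ`. -/
def lin (x : Fin K → ℝ) (θ : Param K) : ℝ := ∑ j, x j * coef θ j

@[fun_prop]
lemma measurable_lin {α : Type*} [MeasurableSpace α] {g : α → Fin K → ℝ} {h : α → Param K}
    (hg : Measurable g) (hh : Measurable h) : Measurable fun a => lin (g a) (h a) := by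
  unfold lin
  apply Finset.measurable_sum
  intro j _
  exact ((measurable_pi_apply j).comp hg).mul ((measurable_coef j).comp hh)

lemma GLM.density_eq (M : GLM) (θ : Param K) (z : Obs K) :
    M.density θ z = M.f z.2 (lin z.1 θ) := by
  rw [GLM.density, lin]
  congr 1
  rw [← Finset.sum_subset (Finset.subset_univ θ.1) (f := fun j => z.1 j * coef θ j)
    (fun j _ hj => by rw [coef_of_notMem hj, mul_zero]),
    ← Finset.sum_coe_sort θ.1 (fun j => z.1 j * coef θ j)]
  refine Finset.sum_congr rfl fun j _ => ?_
  rw [← coef_mk_coe]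

lemma abs_sum_mul_le {x b : Fin K → ℝ} (hx : ∀ j, |x j| ≤ 1) (s : Finset (Fin K)) :
    |∑ j ∈ s, x j * b j| ≤ ∑ j ∈ s, |b j| := by
  refine (Finset.abs_sum_le_sum_abs _ _).trans (Finset.sum_le_sum fun j _ => ?_)
  rw [abs_mul]
  exact mul_le_of_le_one_left (abs_nonneg _) (hx j)

end Coefficients

/-! ### The prior on models. -/

section ModelPrior

variable {K r rbar : ℕ}

lemma bernoulliWeight_eq (lam : ℝ) (γ : Finset (Fin K)) :
    bernoulliWeight lam γ = lam ^ γ.card * (1 - lam) ^ (K - γ.card) := by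
  rw [bernoulliWeight, Finset.prod_ite]
  simp [← Finset.compl_eq_univ_sdiff, Finset.filter_not, Finset.card_compl]

lemma bernoulliWeight_nonneg {lam : ℝ} (h0 : 0 ≤ lam) (h1 : lam ≤ 1) (γ : Finset (Fin K)) :
    0 ≤ bernoulliWeight lam γ := by
  rw [bernoulliWeight_eq]
  have := sub_nonneg.2 h1
  positivity

lemma sum_bernoulliWeight (lam : ℝ) : ∑ γ : Finset (Fin K), bernoulliWeight lam γ = 1 := by
  simp_rw [bernoulliWeight_eq]
  have := Fintype.sum_pow_mul_eq_add_pow (Fin K) lam (1 - lam)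
  simpa using this

/-- The normalizing constant of `modelPrior`. -/
def modelNorm (K r rbar : ℕ) : ℝ :=
  ∑ γ : Finset (Fin K), if γ.card ≤ rbar then bernoulliWeight ((r : ℝ) / K) γ else 0

lemma ratio_mem (hr : 1 ≤ r) (hrK : r < K) : 0 < (r : ℝ) / K ∧ (r : ℝ) / K < 1 := by
  have : (0 : ℝ) < r := by exact_mod_cast hr
  have h2 : (r : ℝ) < K := by exact_mod_cast hrK
  exact ⟨div_pos this (this.trans h2), (div_lt_one (this.trans h2)).2 h2⟩

lemma modelTerm_nonneg (hr : 1 ≤ r) (hrK : r < K) (γ : Finset (Fin K)) :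
    0 ≤ if γ.card ≤ rbar then bernoulliWeight ((r : ℝ) / K) γ else 0 := by
  obtain ⟨h0, h1⟩ := ratio_mem hr hrK
  split_ifs
  · exact bernoulliWeight_nonneg h0.le h1.le γ
  · exact le_rfl

lemma modelNorm_pos (hr : 1 ≤ r) (hrK : r < K) : 0 < modelNorm K r rbar := by
  obtain ⟨h0, h1⟩ := ratio_mem hr hrK
  refine Finset.sum_pos' (fun γ _ => modelTerm_nonneg hr hrK γ) ⟨∅, Finset.mem_univ _, ?_⟩
  rw [if_pos (by simp), bernoulliWeight_eq]
  have := sub_pos.2 h1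
  positivity

lemma modelNorm_le_one (hr : 1 ≤ r) (hrK : r < K) : modelNorm K r rbar ≤ 1 := by
  obtain ⟨h0, h1⟩ := ratio_mem hr hrK
  rw [← sum_bernoulliWeight (K := K) ((r : ℝ) / K)]
  refine Finset.sum_le_sum fun γ _ => ?_
  split_ifs
  · exact le_rfl
  · exact bernoulliWeight_nonneg h0.le h1.le γ

lemma modelPrior_nonneg (hr : 1 ≤ r) (hrK : r < K) (γ : Finset (Fin K)) :
    0 ≤ modelPrior r rbar γ :=
  div_nonneg (modelTerm_nonneg hr hrK γ) (modelNorm_pos hr hrK).le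

lemma sum_modelPrior (hr : 1 ≤ r) (hrK : r < K) :
    ∑ γ : Finset (Fin K), modelPrior r rbar γ = 1 := by
  unfold modelPrior
  rw [← Finset.sum_div]
  exact div_self (modelNorm_pos hr hrK).ne'

lemma modelPrior_eq_zero {γ : Finset (Fin K)} (h : rbar < γ.card) : modelPrior r rbar γ = 0 := by
  rw [modelPrior, if_neg (not_le.2 h), zero_div]

/-- Use r/K ≥ 1/K for the included indices and 1 - x ≥ exp(-2x) on [0, 1/2] for the excluded ones.
Truncating the model size only raises the weight, since the normalizing constant is at most 1. -/
lemma exp_le_modelPrior (hr : 1 ≤ r) (hrK : r < K) (hrb : r ≤ rbar) (hhalf : (r : ℝ) / K ≤ 1 / 2)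
    {γ : Finset (Fin K)} (hγ : γ.card = r) :
    Real.exp (-(r * Real.log K) - 2 * r) ≤ modelPrior r rbar γ := by
  obtain ⟨h0, h1⟩ := ratio_mem hr hrK
  have K0 : (0 : ℝ) < K := by exact_mod_cast (by omega : 0 < K)
  have hx : Real.exp (-(2 * ((r : ℝ) / K))) ≤ 1 - (r : ℝ) / K := by
    rw [Real.exp_neg, inv_le_comm₀ (Real.exp_pos _) (by linarith)]
    have := Real.add_one_le_exp (2 * ((r : ℝ) / K))
    refine le_trans ?_ this
    rw [inv_le_iff_one_le_mul₀ (by linarith)]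
    nlinarith
  calc Real.exp (-(r * Real.log K) - 2 * r)
      = ((K : ℝ)⁻¹) ^ r * Real.exp (-(2 * ((r : ℝ) / K))) ^ K := by
        rw [← Real.exp_nat_mul, ← Real.exp_log (inv_pos.2 K0), ← Real.exp_nat_mul, ← Real.exp_add,
          Real.log_inv]
        congr 1
        field_simp
        ring
    _ ≤ ((r : ℝ) / K) ^ r * (1 - (r : ℝ) / K) ^ K := by
        gcongr
        rw [inv_eq_one_div]
        gcongr
        exact_mod_cast hr
    _ ≤ ((r : ℝ) / K) ^ r * (1 - (r : ℝ) / K) ^ (K - r) := by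
        gcongr 1
        exact pow_le_pow_of_le_one (by linarith) (by linarith) (Nat.sub_le _ _)
    _ = bernoulliWeight ((r : ℝ) / K) γ := by rw [bernoulliWeight_eq, hγ]
    _ ≤ bernoulliWeight ((r : ℝ) / K) γ / modelNorm K r rbar :=
        le_div_self (bernoulliWeight_nonneg h0.le h1.le γ) (modelNorm_pos hr hrK)
          (modelNorm_le_one hr hrK)
    _ = modelPrior r rbar γ := by rw [modelPrior, if_pos (hγ.le.trans hrb), modelNorm]

end ModelPrior

/-! ### Prior mass of cubes and of the complement of the sieve. -/

section Prior

variable {K r rbar : ℕ} {V : (γ : Finset (Fin K)) → Matrix γ γ ℝ}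

lemma prior_apply (s : Set (Param K)) : prior r rbar V s =
    ∑ γ : Finset (Fin K), ENNReal.ofReal (modelPrior r rbar γ) *
      (multivariateGaussian (0 : EuclideanSpace ℝ γ) (V γ)).map (fun v => (⟨γ, v⟩ : Param K)) s := by
  simp [prior, Measure.finsetSum_apply]

lemma isProbabilityMeasure_prior (hr : 1 ≤ r) (hrK : r < K) :
    IsProbabilityMeasure (prior r rbar V) := by
  constructor
  rw [prior_apply]
  have : ∀ γ : Finset (Fin K), (multivariateGaussian (0 : EuclideanSpace ℝ γ) (V γ)).map
      (fun v => (⟨γ, v⟩ : Param K)) Set.univ = 1 := by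
    intro γ
    rw [Measure.map_apply (measurable_paramMk γ) MeasurableSet.univ]
    simp
  simp_rw [this, mul_one]
  rw [← ENNReal.ofReal_sum_of_nonneg (fun γ _ => modelPrior_nonneg hr hrK γ), sum_modelPrior hr hrK,
    ENNReal.ofReal_one]

lemma le_prior_cube {γ : Finset (Fin K)} (β : Fin K → ℝ) (η : ℝ) :
    ENNReal.ofReal (modelPrior r rbar γ) * multivariateGaussian (0 : EuclideanSpace ℝ γ) (V γ)
        {v | ∀ j, |v j - β j| ≤ η} ≤
      prior r rbar V {θ | θ.1 = γ ∧ ∀ j ∈ γ, |coef θ j - β j| ≤ η} := by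
  rw [prior_apply]
  refine le_trans ?_ (Finset.single_le_sum (fun _ _ => zero_le) (Finset.mem_univ γ))
  gcongr
  refine (measure_mono ?_).trans
    (Measure.le_map_apply (measurable_paramMk γ).aemeasurable _)
  intro v hv
  refine ⟨rfl, fun j hj => ?_⟩
  have := hv ⟨j, hj⟩
  rwa [← coef_mk_coe] at this

lemma ch₁_le_supEigLe {γ : Finset (Fin K)} (hγ : γ.card ≤ rbar) :
    ch₁ (V γ) ≤ supEigLe V rbar :=
  le_ciSup (f := fun γ : {γ : Finset (Fin K) // γ.card ≤ rbar} => ch₁ (V γ.1))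
    (Set.finite_range _).bddAbove ⟨γ, hγ⟩

lemma ch₁_le_supEig {γ : Finset (Fin K)} (hγ : γ.card = r) : ch₁ (V γ) ≤ supEig V r :=
  le_ciSup (f := fun γ : {γ : Finset (Fin K) // γ.card = r} => ch₁ (V γ.1))
    (Set.finite_range _).bddAbove ⟨γ, hγ⟩

lemma ch₁_inv_le_supInvEig {γ : Finset (Fin K)} (hγ : γ.card = r) :
    ch₁ (V γ)⁻¹ ≤ supInvEig V r :=
  le_ciSup (f := fun γ : {γ : Finset (Fin K) // γ.card = r} => ch₁ (V γ.1)⁻¹)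
    (Set.finite_range _).bddAbove ⟨γ, hγ⟩

/-- The parameters outside the sieve: too large a model or too large a coefficient. -/
def offSieve (K rbar : ℕ) (C : ℝ) : Set (Param K) := {θ | rbar < θ.1.card ∨ ∃ j, C < |coef θ j|}

lemma measurableSet_offSieve (C : ℝ) : MeasurableSet (offSieve K rbar C) := by
  apply measurableSet_sigma
  intro γ
  have : Sigma.mk γ ⁻¹' (offSieve K rbar C) =
      {_v : EuclideanSpace ℝ γ | rbar < γ.card} ∪ ⋃ j, {v | C < |coef ⟨γ, v⟩ j|} := by
    ext v
    simp [offSieve]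
  rw [this]
  refine (MeasurableSet.const _).union (MeasurableSet.iUnion fun j => ?_)
  exact measurableSet_lt measurable_const
    (((measurable_coef j).comp (measurable_paramMk γ)).abs)

/-- Models that are too large have prior weight 0; in every other model a union bound over at most
`rbar` coordinates applies, with a variance bound uniform over models. -/
lemma prior_offSieve_le (hr : 1 ≤ r) (hrK : r < K) (hV : ∀ γ, γ.card ≤ rbar → (V γ).PosDef)
    {C : ℝ} (hC : 0 ≤ C) :
    prior r rbar V (offSieve K rbar C) ≤
      ENNReal.ofReal (rbar * (2 * Real.exp (-(C ^ 2 / (2 * supEigLe V rbar))))) := by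
  rw [prior_apply]
  set T := rbar * (2 * Real.exp (-(C ^ 2 / (2 * supEigLe V rbar)))) with hT
  calc _ ≤ ∑ γ : Finset (Fin K), ENNReal.ofReal (modelPrior r rbar γ) * ENNReal.ofReal T := by
        refine Finset.sum_le_sum fun γ _ => ?_
        rcases lt_or_ge rbar γ.card with h | h
        · simp [modelPrior_eq_zero h]
        gcongr
        rw [Measure.map_apply (measurable_paramMk γ) (measurableSet_offSieve C)]
        have hsub : (fun v => (⟨γ, v⟩ : Param K)) ⁻¹' (offSieve K rbar C) ⊆
            ⋃ j : γ, {v | C < |v j|} := by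
          rintro v (hv | ⟨j, hj⟩)
          · exact absurd hv (not_lt.2 h)
          · rw [Set.mem_iUnion]
            by_cases hjγ : j ∈ γ
            · refine ⟨⟨j, hjγ⟩, ?_⟩
              rwa [show coef ⟨γ, v⟩ j = v ⟨j, hjγ⟩ from coef_mk_coe γ v ⟨j, hjγ⟩] at hj
            · rw [coef_of_notMem hjγ, abs_zero] at hj
              exact absurd hj (not_lt.2 hC)
        calc _ ≤ _ := measure_mono hsub
          _ ≤ ∑ j : γ, multivariateGaussian (0 : EuclideanSpace ℝ γ) (V γ) {v | C < |v j|} :=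
              measure_iUnion_fintype_le _ _
          _ ≤ ∑ _j : γ, ENNReal.ofReal (2 * Real.exp (-(C ^ 2 / (2 * supEigLe V rbar)))) :=
              Finset.sum_le_sum fun j _ =>
                multivariateGaussian_coord_tail_le (hV γ h) j (ch₁_le_supEigLe h) hC
          _ ≤ _ := by
              rw [hT, Finset.sum_const, Finset.card_univ, Fintype.card_coe,
                ENNReal.ofReal_mul (Nat.cast_nonneg _), ENNReal.ofReal_natCast, nsmul_eq_mul]
              gcongr
    _ = _ := by
        rw [← Finset.sum_mul, ← ENNReal.ofReal_sum_of_nonneg (fun γ _ => modelPrior_nonneg hr hrK γ),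
          sum_modelPrior hr hrK, ENNReal.ofReal_one, one_mul]

lemma supEigLe_pos (hr : 1 ≤ rbar) (hK : 1 ≤ K) (hV : ∀ γ, γ.card ≤ rbar → (V γ).PosDef) :
    0 < supEigLe V rbar := by
  have hc : ({⟨0, hK⟩} : Finset (Fin K)).card ≤ rbar := by simpa using hr
  exact (hV _ hc).diag_pos.trans_le ((diag_le_ch₁ (hV _ hc)
    ⟨⟨0, hK⟩, Finset.mem_singleton_self _⟩).trans (ch₁_le_supEigLe hc))

end Prior

/-! ### The law of the data, likelihood ratios and Hellinger envelopes. -/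

section Laws

variable (M : GLM) {K : ℕ} (νx : Measure (Fin K → ℝ)) (β : Fin K → ℝ)

namespace GLM

lemma trueDensity_pos (z : Obs K) : 0 < M.trueDensity β z := M.f_pos _ _

lemma density_pos (θ : Param K) (z : Obs K) : 0 < M.density θ z := M.f_pos _ _

@[fun_prop]
lemma measurable_trueDensity : Measurable (M.trueDensity β) := by
  unfold trueDensity
  fun_prop

@[fun_prop]
lemma measurable_density {α : Type*} [MeasurableSpace α] {g : α → Param K} {h : α → Obs K}
    (hg : Measurable g) (hh : Measurable h) : Measurable fun a => M.density (g a) (h a) := by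
  simp_rw [density_eq]
  fun_prop

lemma lintegral_trueLaw {g : Obs K → ℝ≥0∞} (hg : Measurable g) :
    ∫⁻ z, g z ∂(M.trueLaw νx β) =
      ∫⁻ z, ENNReal.ofReal (M.trueDensity β z) * g z ∂(M.dom νx) := by
  rw [trueLaw, lintegral_withDensity_eq_lintegral_mul _ (by fun_prop) hg]
  rfl

lemma ae_trueLaw_of_ae {p : (Fin K → ℝ) → Prop} (h : ∀ᵐ x ∂νx, p x) :
    ∀ᵐ z ∂(M.trueLaw νx β), p z.1 := by
  refine (withDensity_absolutelyContinuous _ _).ae_le ?_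
  exact Measure.quasiMeasurePreserving_fst.ae h

variable [IsProbabilityMeasure νx]

instance : SFinite (M.dom νx) := by unfold dom; infer_instance

lemma lintegral_dom_f {s : (Fin K → ℝ) → ℝ} (hs : Measurable s) :
    ∫⁻ z, ENNReal.ofReal (M.f z.2 (s z.1)) ∂(M.dom νx) = 1 := by
  rw [dom, lintegral_prod _ (by fun_prop)]
  simp [lintegral_f]

lemma lintegral_density_eq_one (θ : Param K) :
    ∫⁻ z, ENNReal.ofReal (M.density θ z) ∂(M.dom νx) = 1 := by
  simp_rw [density_eq]
  exact M.lintegral_dom_f νx (s := fun x => lin x θ) (by fun_prop)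

lemma lintegral_trueDensity_eq_one :
    ∫⁻ z, ENNReal.ofReal (M.trueDensity β z) ∂(M.dom νx) = 1 :=
  M.lintegral_dom_f νx (s := fun x => ∑ j, x j * β j) (by fun_prop)

instance isProbabilityMeasure_trueLaw : IsProbabilityMeasure (M.trueLaw νx β) := by
  constructor
  rw [trueLaw, withDensity_apply _ MeasurableSet.univ, Measure.restrict_univ,
    lintegral_trueDensity_eq_one]

/-- The likelihood ratio of one observation. -/
def ratio (z : Obs K) (θ : Param K) : ℝ≥0∞ :=
  ENNReal.ofReal (M.density θ z / M.trueDensity β z)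

@[fun_prop]
lemma measurable_ratio {α : Type*} [MeasurableSpace α] {g : α → Obs K} {h : α → Param K}
    (hg : Measurable g) (hh : Measurable h) : Measurable fun a => M.ratio β (g a) (h a) := by
  unfold ratio
  fun_prop

lemma measurable_uncurry_ratio : Measurable (Function.uncurry (M.ratio β)) :=
  M.measurable_ratio β measurable_fst measurable_snd

lemma ratio_ne_zero (z : Obs K) (θ : Param K) : M.ratio β z θ ≠ 0 :=
  (ENNReal.ofReal_pos.2 (div_pos (M.density_pos θ z) (M.trueDensity_pos β z))).ne'

lemma ratio_ne_top (z : Obs K) (θ : Param K) : M.ratio β z θ ≠ ∞ := ENNReal.ofReal_ne_top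

lemma lintegral_ratio (θ : Param K) : ∫⁻ z, M.ratio β z θ ∂(M.trueLaw νx β) = 1 := by
  unfold ratio
  rw [lintegral_trueLaw _ _ _ (by fun_prop), ← M.lintegral_density_eq_one νx θ]
  refine lintegral_congr fun z => ?_
  have := M.trueDensity_pos β z
  rw [← ENNReal.ofReal_mul this.le, mul_div_cancel₀ _ this.ne']

lemma ratio_inv (z : Obs K) (θ : Param K) :
    (M.ratio β z θ)⁻¹ = ENNReal.ofReal (M.trueDensity β z / M.density θ z) := by
  rw [ratio, ← ENNReal.ofReal_inv_of_pos (div_pos (M.density_pos θ z) (M.trueDensity_pos β z)),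
    inv_div]

/-- The left side is ∫ p*²/p; by Fubini it suffices to bound the inner integral over y for almost
every covariate vector. -/
lemma lintegral_ratio_inv_le {A : ℝ≥0∞} {θ : Param K}
    (h : ∀ᵐ x ∂νx, ∫⁻ y, ENNReal.ofReal (M.f y (∑ j, x j * β j) / M.f y (lin x θ) *
      M.f y (∑ j, x j * β j)) ∂M.ν ≤ A) :
    ∫⁻ z, (M.ratio β z θ)⁻¹ ∂(M.trueLaw νx β) ≤ A := by
  simp_rw [ratio_inv]
  rw [lintegral_trueLaw _ _ _ (by fun_prop)]
  have e : ∀ z : Obs K, ENNReal.ofReal (M.trueDensity β z) *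
      ENNReal.ofReal (M.trueDensity β z / M.density θ z) =
      ENNReal.ofReal (M.f z.2 (∑ j, z.1 j * β j) / M.f z.2 (lin z.1 θ) *
        M.f z.2 (∑ j, z.1 j * β j)) := by
    intro z
    rw [← ENNReal.ofReal_mul (M.trueDensity_pos β z).le, density_eq, trueDensity, mul_comm]
  simp_rw [e]
  rw [dom, lintegral_prod _ (by fun_prop)]
  calc _ ≤ ∫⁻ _, A ∂νx := lintegral_mono_ae h
    _ = A := by simp

/-- The true likelihood of the data is positive and finite, so it cancels between numerator and
evidence, even where these are infinite. -/
lemma posterior_eq {n : ℕ} (π : Measure (Param K)) [SFinite π] (data : Fin n → Obs K)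
    (B : Set (Param K)) :
    M.posterior π data B = (∫⁻ θ, ∏ i, M.ratio β (data i) θ ∂π)⁻¹ *
      ∫⁻ θ in B, ∏ i, M.ratio β (data i) θ ∂π := by
  set c : ℝ≥0∞ := ∏ i, ENNReal.ofReal (M.trueDensity β (data i)) with hc
  have hc0 : c ≠ 0 := Finset.prod_ne_zero_iff.2 fun i _ =>
    (ENNReal.ofReal_pos.2 (M.trueDensity_pos β _)).ne'
  have hc' : c ≠ ∞ := ENNReal.prod_ne_top fun i _ => ENNReal.ofReal_ne_top
  have e : ∀ θ, M.likelihood data θ = c * ∏ i, M.ratio β (data i) θ := by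
    intro θ
    rw [likelihood, hc, ← Finset.prod_mul_distrib]
    refine Finset.prod_congr rfl fun i _ => ?_
    have := M.trueDensity_pos β (data i)
    rw [ratio, ← ENNReal.ofReal_mul this.le, mul_div_cancel₀ _ this.ne']
  rw [posterior, Measure.smul_apply, withDensity_apply', smul_eq_mul]
  simp_rw [e]
  rw [lintegral_const_mul' _ _ hc', lintegral_const_mul' _ _ hc',
    ENNReal.mul_inv (Or.inl hc0) (Or.inl hc'), mul_mul_mul_comm, ENNReal.inv_mul_cancel hc0 hc',
    one_mul]

lemma posterior_univ {n : ℕ} (π : Measure (Param K)) [IsProbabilityMeasure π]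
    (data : Fin n → Obs K) (h : ∫⁻ θ, ∏ i, M.ratio β (data i) θ ∂π ≠ ∞) :
    M.posterior π data Set.univ = 1 := by
  rw [M.posterior_eq β, Measure.restrict_univ]
  refine ENNReal.inv_mul_cancel ?_ h
  have hm : Measurable fun θ => ∏ i, M.ratio β (data i) θ := by
    apply Finset.measurable_prod
    intro i _
    fun_prop
  rw [ne_eq, lintegral_eq_zero_iff hm]
  intro h0
  have : ∀ᵐ _θ ∂π, False := by
    filter_upwards [h0] with θ hθ
    exact Finset.prod_ne_zero_iff.2 (fun i _ => M.ratio_ne_zero β (data i) θ) hθ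
  simp [IsProbabilityMeasure.ne_zero π] at this

/-- By Tonelli the evidence, relative to the true likelihood, has expectation 1 under the truth.
This makes the posterior almost surely a probability. -/
lemma ae_lintegral_ratio_ne_top {n : ℕ} (π : Measure (Param K)) [IsProbabilityMeasure π] :
    ∀ᵐ data ∂(M.dataLaw νx β n), ∫⁻ θ, ∏ i, M.ratio β (data i) θ ∂π ≠ ∞ := by
  have hprod : Measurable (Function.uncurry
      fun (x : Fin n → Obs K) θ => ∏ i, M.ratio β (x i) θ) := by
    apply Finset.measurable_prod
    intro i _
    exact M.measurable_ratio β (g := fun p : (Fin n → Obs K) × Param K => p.1 i)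
      (by fun_prop) measurable_snd
  have : ∫⁻ data, ∫⁻ θ, ∏ i, M.ratio β (data i) θ ∂π ∂(M.dataLaw νx β n) ≠ ∞ := by
    unfold dataLaw
    rw [lintegral_lintegral_swap hprod.aemeasurable]
    have e : ∀ θ, ∫⁻ data : Fin n → Obs K, ∏ i, M.ratio β (data i) θ
        ∂(Measure.pi fun _ => M.trueLaw νx β) = 1 := by
      intro θ
      rw [lintegral_pi_prod _ n (g := fun z => M.ratio β z θ) (by fun_prop), lintegral_ratio,
        one_pow]
    simp [e]
  filter_upwards [ae_lt_top hprod.lintegral_prod_right this] with data h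
  exact h.ne

lemma affinity_le_of_lt_hellinger {θ : Param K} {ε : ℝ} (hε : 0 ≤ ε)
    (h : ε < M.hellinger νx β θ) :
    ∫⁻ z, ENNReal.ofReal (√(M.density θ z) * √(M.trueDensity β z)) ∂(M.dom νx) ≤
      ENNReal.ofReal (1 - ε ^ 2 / 2) := by
  have hsum := lintegral_sq_sqrt_sub_add (μ := M.dom νx) (p := fun z => M.density θ z) (q := M.trueDensity β)
    (by fun_prop) (by fun_prop) (fun z => (M.density_pos θ z).le)
    (fun z => (M.trueDensity_pos β z).le) (M.lintegral_density_eq_one νx θ)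
    (M.lintegral_trueDensity_eq_one νx β)
  rw [hellinger, integral_eq_lintegral_of_nonneg_ae (Eventually.of_forall fun z => sq_nonneg _)
    (Measurable.aestronglyMeasurable (by fun_prop)), Real.lt_sqrt hε] at h
  set X := ∫⁻ z, ENNReal.ofReal ((√(M.density θ z) - √(M.trueDensity β z)) ^ 2) ∂(M.dom νx)
  set Y := ∫⁻ z, ENNReal.ofReal (√(M.density θ z) * √(M.trueDensity β z)) ∂(M.dom νx)
  have hX : X ≠ ∞ := ne_top_of_le_ne_top (by simp) (le_self_add.trans hsum.le)
  have hY : Y ≠ ∞ := by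
    intro hY
    rw [hY] at hsum
    simp at hsum
  rw [← ENNReal.ofReal_toReal hY]
  apply ENNReal.ofReal_le_ofReal
  have := congrArg ENNReal.toReal hsum
  rw [ENNReal.toReal_add hX (ENNReal.mul_ne_top (by simp) hY), ENNReal.toReal_mul] at this
  simp only [ENNReal.toReal_ofNat] at this
  linarith

/-- The affinity deficit ε²/2, less the envelope error ε²/8, leaves 3ε²/8; the exponential factor
costs at most ε²/512 more, because ε⁴ ≤ ε². -/
lemma exp_mul_le_exp_neg {ε κ : ℝ} (hε : 0 < ε) (hε1 : ε ≤ 1) (hκ : κ ≤ ε ^ 4 / 512) :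
    Real.exp κ * (1 - ε ^ 2 / 2 + ε ^ 2 / 8) ≤ Real.exp (-(ε ^ 2 / 4)) := by
  have h1 : 1 - ε ^ 2 / 2 + ε ^ 2 / 8 ≤ Real.exp (-(3 * ε ^ 2 / 8)) := by
    linarith [Real.add_one_le_exp (-(3 * ε ^ 2 / 8))]
  calc _ ≤ Real.exp κ * Real.exp (-(3 * ε ^ 2 / 8)) := by gcongr
    _ = Real.exp (κ + -(3 * ε ^ 2 / 8)) := (Real.exp_add _ _).symm
    _ ≤ _ := by
      apply Real.exp_le_exp.2
      have : ε ^ 4 ≤ ε ^ 2 := pow_le_pow_of_le_one hε.le hε1 (by norm_num)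
      nlinarith [sq_nonneg ε]

/-- A set of parameters at Hellinger distance more than `ε` from the truth, whose linear predictors
are within `δ` of each other, has an upper envelope of affinity at most `exp (-ε² / 4)`. -/
lemma exists_envelope (hx : ∀ᵐ x ∂νx, ∀ j, |x j| ≤ 1) {R δ ε : ℝ} (hδ : 0 ≤ δ) (hε : 0 < ε)
    (hε1 : ε ≤ 1) (hδε : δ * M.slope R ≤ ε ^ 4 / 512) {C : Set (Param K)}
    (hR : ∀ θ ∈ C, ∀ x : Fin K → ℝ, (∀ j, |x j| ≤ 1) → |lin x θ| ≤ R)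
    (hC : ∀ θ ∈ C, ∀ θ' ∈ C, ∀ x : Fin K → ℝ, (∀ j, |x j| ≤ 1) → |lin x θ - lin x θ'| ≤ δ)
    (hfar : ∀ θ ∈ C, ε < M.hellinger νx β θ) :
    ∃ F : Obs K → ℝ≥0∞, Measurable F ∧
      (∀ᵐ z ∂(M.trueLaw νx β), ∀ θ ∈ C, M.ratio β z θ ≤ F z) ∧
      ∫⁻ z, (F z) ^ (1 / 2 : ℝ) ∂(M.trueLaw νx β) ≤ ENNReal.ofReal (Real.exp (-(ε ^ 2 / 4))) := by
  -- An empty cell takes the zero envelope; otherwise any member serves as the centre, and only its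
  -- own Hellinger distance is used.
  rcases C.eq_empty_or_nonempty with rfl | ⟨θ₀, hθ₀⟩
  · exact ⟨0, measurable_zero, by simp, by simp⟩
  refine ⟨fun z => ENNReal.ofReal (M.upper R δ (lin z.1 θ₀) z.2 / M.trueDensity β z),
    by fun_prop, ?_, ?_⟩
  · filter_upwards [M.ae_trueLaw_of_ae νx β hx] with z hz θ hθ
    unfold ratio
    apply ENNReal.ofReal_le_ofReal
    apply div_le_div_of_nonneg_right _ (M.trueDensity_pos β z).le
    rw [density_eq]
    exact M.f_le_upper hδ (abs_le.1 (hR _ hθ₀ _ hz)) (abs_le.1 (hR _ hθ _ hz))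
      (hC _ hθ _ hθ₀ _ hz) _
  · rw [lintegral_trueLaw _ _ _ (by fun_prop)]
    have e : ∀ z : Obs K, ENNReal.ofReal (M.trueDensity β z) *
        ENNReal.ofReal (M.upper R δ (lin z.1 θ₀) z.2 / M.trueDensity β z) ^ (1 / 2 : ℝ) =
        ENNReal.ofReal (√(M.upper R δ (lin z.1 θ₀) z.2) * √(M.f z.2 (∑ j, z.1 j * β j))) := by
      intro z
      have hu := M.upper_pos R δ (lin z.1 θ₀) z.2
      have ht := M.trueDensity_pos β z
      rw [ENNReal.ofReal_rpow_of_pos (div_pos hu ht), ← Real.sqrt_eq_rpow,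
        ← ENNReal.ofReal_mul ht.le, Real.sqrt_div hu.le]
      congr 1
      change _ = _ * √(M.trueDensity β z)
      have h0 : 0 < √(M.trueDensity β z) := Real.sqrt_pos.2 ht
      have hs : √(M.trueDensity β z) * √(M.trueDensity β z) = M.trueDensity β z :=
        Real.mul_self_sqrt ht.le
      rw [mul_div_assoc', div_eq_iff h0.ne', mul_assoc, hs, mul_comm]
    simp_rw [e]
    have haff := M.affinity_le_of_lt_hellinger νx β hε.le (hfar _ hθ₀)
    simp_rw [density_eq, trueDensity] at haff
    unfold dom at haff ⊢
    rw [lintegral_prod _ (by fun_prop)] at haff ⊢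
    dsimp only at haff ⊢
    calc _ ≤ ∫⁻ x, ENNReal.ofReal (Real.exp (δ * M.slope R)) *
        (∫⁻ y, ENNReal.ofReal (√(M.f y (lin x θ₀)) * √(M.f y (∑ j, x j * β j))) ∂M.ν +
          ENNReal.ofReal (ε ^ 2 / 8)) ∂νx := by
          apply lintegral_mono_ae
          filter_upwards [hx] with x hx
          exact M.lintegral_sqrt_upper_mul_le hδ hε hδε (abs_le.1 (hR _ hθ₀ _ hx))
      _ = ENNReal.ofReal (Real.exp (δ * M.slope R)) *
        (∫⁻ x, ∫⁻ y, ENNReal.ofReal (√(M.f y (lin x θ₀)) * √(M.f y (∑ j, x j * β j))) ∂M.ν ∂νx +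
          ENNReal.ofReal (ε ^ 2 / 8)) := by
          rw [lintegral_const_mul' _ _ ENNReal.ofReal_ne_top,
            lintegral_add_right _ measurable_const]
          simp
      _ ≤ ENNReal.ofReal (Real.exp (δ * M.slope R)) *
        (ENNReal.ofReal (1 - ε ^ 2 / 2) + ENNReal.ofReal (ε ^ 2 / 8)) := by
          gcongr
      _ = ENNReal.ofReal (Real.exp (δ * M.slope R) * (1 - ε ^ 2 / 2 + ε ^ 2 / 8)) := by
          rw [← ENNReal.ofReal_add (by nlinarith) (by positivity),
            ← ENNReal.ofReal_mul (Real.exp_pos _).le]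
      _ ≤ _ := ENNReal.ofReal_le_ofReal (exp_mul_le_exp_neg hε hε1 hδε)

end GLM

end Laws

/-! ### Discretization of the sieve. -/

section Cells

variable {K : ℕ}

lemma abs_lin_sub_le {x : Fin K → ℝ} (hx : ∀ j, |x j| ≤ 1) (θ : Param K) (b : Fin K → ℝ) :
    |lin x θ - ∑ j, x j * b j| ≤ ∑ j, |coef θ j - b j| := by
  rw [lin, ← Finset.sum_sub_distrib]
  simp_rw [← mul_sub]
  exact abs_sum_mul_le hx _

/-- The index of the cell of side `2 C / N` of `[-C, C]` that contains `x`. -/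
def cellIndex (N : ℕ) (C x : ℝ) : ℕ := ⌊(x + C) / (2 * C) * N⌋₊

/-- The value N does occur, at the right endpoint x = C; this is why cells are indexed by N + 1
values per coordinate. -/
lemma cellIndex_le {N : ℕ} {C x : ℝ} (hC : 0 < C) (hx : |x| ≤ C) : cellIndex N C x ≤ N := by
  have h := abs_le.1 hx
  have : (x + C) / (2 * C) ≤ 1 := by rw [div_le_one (by positivity)]; linarith
  calc cellIndex N C x ≤ ⌊(1 : ℝ) * N⌋₊ := Nat.floor_mono (by gcongr)
    _ = N := by simp

lemma abs_sub_le_of_cellIndex_eq {N : ℕ} {C x y : ℝ} (hN : 0 < N) (hC : 0 < C) (hx : |x| ≤ C)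
    (hy : |y| ≤ C) (h : cellIndex N C x = cellIndex N C y) : |x - y| ≤ 2 * C / N := by
  have hx' := abs_le.1 hx
  have hy' := abs_le.1 hy
  have N0 : (0 : ℝ) < N := by exact_mod_cast hN
  have nx : 0 ≤ (x + C) / (2 * C) * N :=
    mul_nonneg (div_nonneg (by linarith) (by linarith)) N0.le
  have ny : 0 ≤ (y + C) / (2 * C) * N :=
    mul_nonneg (div_nonneg (by linarith) (by linarith)) N0.le
  have h1 := Nat.floor_le nx
  have h2 := Nat.floor_le ny
  have h3 := Nat.lt_floor_add_one ((x + C) / (2 * C) * N)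
  have h4 := Nat.lt_floor_add_one ((y + C) / (2 * C) * N)
  unfold cellIndex at h
  rw [h] at h1 h3
  have e : (x + C) / (2 * C) * N - (y + C) / (2 * C) * N = (x - y) * (N / (2 * C)) := by
    field_simp; ring
  have hle : |(x - y) * (N / (2 * C))| ≤ 1 := by
    rw [← e, abs_le]; constructor <;> linarith
  rw [abs_mul, abs_of_pos (by positivity : 0 < N / (2 * C))] at hle
  rw [le_div_iff₀ N0]
  calc |x - y| * N = (|x - y| * (N / (2 * C))) * (2 * C) := by field_simp
    _ ≤ 1 * (2 * C) := by gcongr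
    _ = 2 * C := one_mul _

/-- The parameters with model `j.1` whose coefficients have cell indices `j.2`. -/
def cell (N : ℕ) (C : ℝ) (j : Σ γ : Finset (Fin K), (γ → Fin (N + 1))) : Set (Param K) :=
  {θ | θ.1 = j.1 ∧ ∀ i : j.1, cellIndex N C (coef θ i) = j.2 i}

/-- The cells whose model has size at most `rbar`. -/
def cellFinset (K N rbar : ℕ) : Finset (Σ γ : Finset (Fin K), (γ → Fin (N + 1))) :=
  Finset.univ.filter fun j => j.1.card ≤ rbar

/-- There are K + 1 possible sizes, and at size k at most K^k models with (N + 1)^k cells each. -/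
lemma card_cellFinset_le {N rbar : ℕ} (hK : 1 ≤ K) :
    (cellFinset K N rbar).card ≤ (K + 1) * (K * (N + 1)) ^ rbar := by
  have h1 : (cellFinset K N rbar).card =
      ∑ γ : Finset (Fin K), if γ.card ≤ rbar then (N + 1) ^ γ.card else 0 := by
    rw [cellFinset, Finset.card_filter, ← Finset.univ_sigma_univ, Finset.sum_sigma]
    refine Finset.sum_congr rfl fun γ _ => ?_
    split_ifs <;> simp
  rw [h1, ← Finset.powerset_univ, Finset.sum_powerset_apply_card
    (fun k => if k ≤ rbar then (N + 1) ^ k else 0)]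
  rw [Finset.card_univ, Fintype.card_fin]
  calc _ ≤ ∑ _m ∈ Finset.range (K + 1), (K * (N + 1)) ^ rbar := by
        refine Finset.sum_le_sum fun k _ => ?_
        split_ifs with hk
        · rw [smul_eq_mul]
          calc _ ≤ K ^ k * (N + 1) ^ k := by gcongr; exact Nat.choose_le_pow _ _
            _ = (K * (N + 1)) ^ k := (mul_pow _ _ _).symm
            _ ≤ _ := Nat.pow_le_pow_right (by positivity) hk
        · simp
    _ = _ := by simp

lemma compl_offSieve_subset {N rbar : ℕ} {C : ℝ} (hC : 0 < C) (B : Set (Param K)) :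
    B ⊆ (⋃ j ∈ cellFinset K N rbar, cell N C j ∩ (B \ offSieve K rbar C)) ∪ offSieve K rbar C := by
  intro θ hθ
  by_cases h : θ ∈ offSieve K rbar C
  · exact Or.inr h
  left
  have h' := h
  simp only [offSieve, Set.mem_ofPred_eq, not_or, not_lt, not_exists] at h'
  simp only [Set.mem_iUnion]
  refine ⟨⟨θ.1, fun i => ⟨cellIndex N C (coef θ i), Nat.lt_succ_of_le (cellIndex_le hC (h'.2 _))⟩⟩,
    ?_, ⟨rfl, fun i => rfl⟩, hθ, h⟩
  simp only [cellFinset, Finset.mem_filter, Finset.mem_univ, true_and]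
  exact h'.1

lemma sum_abs_le_of_card_le {θ : Param K} {rbar : ℕ} {D : ℝ} (hcard : θ.1.card ≤ rbar)
    {g : Fin K → ℝ} (hD : 0 ≤ D) (h0 : ∀ j ∉ θ.1, g j = 0) (h : ∀ j ∈ θ.1, |g j| ≤ D) :
    ∑ j, |g j| ≤ rbar * D := by
  rw [← Finset.sum_subset (Finset.subset_univ θ.1) fun j _ hj => by rw [h0 j hj, abs_zero]]
  calc _ ≤ θ.1.card • D := Finset.sum_le_card_nsmul _ _ _ h
    _ = θ.1.card * D := nsmul_eq_mul _ _
    _ ≤ _ := by gcongr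

lemma abs_lin_le_of_notMem_offSieve {θ : Param K} {rbar : ℕ} {C : ℝ} (hC : 0 ≤ C)
    (h : θ ∉ offSieve K rbar C) {x : Fin K → ℝ} (hx : ∀ j, |x j| ≤ 1) : |lin x θ| ≤ rbar * C := by
  simp only [offSieve, Set.mem_ofPred_eq, not_or, not_lt, not_exists] at h
  exact (abs_sum_mul_le hx _).trans
    (sum_abs_le_of_card_le h.1 hC (fun j hj => coef_of_notMem hj) fun j _ => h.2 j)

lemma abs_lin_sub_lin_le {N rbar : ℕ} {C : ℝ} (hN : 0 < N) (hC : 0 < C)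
    {j : Σ γ : Finset (Fin K), (γ → Fin (N + 1))} {θ θ' : Param K}
    (hθ : θ ∈ cell N C j) (hθ' : θ' ∈ cell N C j) (h : θ ∉ offSieve K rbar C)
    (h' : θ' ∉ offSieve K rbar C) {x : Fin K → ℝ} (hx : ∀ j, |x j| ≤ 1) :
    |lin x θ - lin x θ'| ≤ rbar * (2 * C / N) := by
  simp only [offSieve, Set.mem_ofPred_eq, not_or, not_lt, not_exists] at h h'
  refine (abs_lin_sub_le hx θ (coef θ')).trans
    (sum_abs_le_of_card_le h.1 (by positivity) (fun i hi => ?_) fun i hi => ?_)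
  · rw [coef_of_notMem hi, coef_of_notMem (by rwa [hθ'.1, ← hθ.1]), sub_zero]
  · refine abs_sub_le_of_cellIndex_eq hN hC (h.2 i) (h'.2 i) ?_
    have hi' : i ∈ j.1 := hθ.1 ▸ hi
    rw [hθ.2 ⟨i, hi'⟩, hθ'.2 ⟨i, hi'⟩]

end Cells

/-! ### The majorant at a fixed sample size. -/

section Stage

variable (M : GLM) {K r rbar : ℕ} (νx : Measure (Fin K → ℝ)) [IsProbabilityMeasure νx]
  (β : Fin K → ℝ) {V : (γ : Finset (Fin K)) → Matrix γ γ ℝ}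

/-- Inside the sieve predictors are at most rbar C in absolute value, and within a cell they differ
by at most rbar · 2C/N. The condition on N is the oscillation bound required for the envelope of
every cell. -/
lemma exists_posterior_far_majorant (n : ℕ) (hx : ∀ᵐ x ∂νx, ∀ j, |x j| ≤ 1)
    (hr : 1 ≤ r) (hrK : r < K) {ε : ℝ} (hε : 0 < ε) (hε1 : ε ≤ 1) {C : ℝ} (hC : 0 < C)
    {N : ℕ} (hN : 0 < N)
    (hNε : rbar * (2 * C / N) * M.slope (rbar * C) ≤ ε ^ 4 / 512)
    {G : Set (Param K)} (hG : prior r rbar V G ≠ 0) {m A : ℝ≥0∞} (hm0 : m ≠ 0) (hm : m ≠ ∞)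
    (hA : ∀ θ ∈ G, ∫⁻ z, (M.ratio β z θ)⁻¹ ∂(M.trueLaw νx β) ≤ A) :
    ∃ g : (Fin n → Obs K) → ℝ≥0∞, Measurable g ∧
      (∀ᵐ data ∂(M.dataLaw νx β n), M.posterior (prior r rbar V) data
        {θ | ε < M.hellinger νx β θ} ≤ g data) ∧
      ∫⁻ data, g data ∂(M.dataLaw νx β n) ≤
        m * A ^ n + (((K + 1) * (K * (N + 1)) ^ rbar : ℕ) *
          ((m * prior r rbar V G)⁻¹ ^ (1 / 2 : ℝ) * ENNReal.ofReal (Real.exp (-(ε ^ 2 / 4))) ^ n) +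
          (m * prior r rbar V G)⁻¹ * prior r rbar V (offSieve K rbar C)) := by
  have := isProbabilityMeasure_prior (V := V) (rbar := rbar) hr hrK
  set B := {θ | ε < M.hellinger νx β θ} with hB
  have henv : ∀ j : Σ γ : Finset (Fin K), (γ → Fin (N + 1)), ∃ F : Obs K → ℝ≥0∞, Measurable F ∧
      (∀ᵐ z ∂(M.trueLaw νx β), ∀ θ ∈ cell N C j ∩ (B \ offSieve K rbar C), M.ratio β z θ ≤ F z) ∧
      ∫⁻ z, (F z) ^ (1 / 2 : ℝ) ∂(M.trueLaw νx β) ≤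
        ENNReal.ofReal (Real.exp (-(ε ^ 2 / 4))) := by
    intro j
    refine M.exists_envelope νx β hx (R := rbar * C) (δ := rbar * (2 * C / N)) (by positivity) hε
      hε1 hNε ?_ ?_ ?_
    · intro θ hθ x hx
      exact abs_lin_le_of_notMem_offSieve hC.le hθ.2.2 hx
    · intro θ hθ θ' hθ' x hx
      exact abs_lin_sub_lin_le hN hC hθ.1 hθ'.1 hθ.2.2 hθ'.2.2 hx
    · intro θ hθ
      exact hθ.2.1
  choose F hFm hFle hFint using henv
  obtain ⟨g, hg, hle, hint⟩ := exists_posterior_majorant (P := M.trueLaw νx β)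
    (π := prior r rbar V) (n := n) (M.measurable_uncurry_ratio β) (M.ratio_ne_zero β) (M.ratio_ne_top β)
    (fun θ => (M.lintegral_ratio νx β θ).le) hG hm0 hm hA (cellFinset K N rbar)
    (fun j => cell N C j ∩ (B \ offSieve K rbar C)) (offSieve K rbar C) B
    (compl_offSieve_subset hC B) F (fun j _ => hFm j) (fun j _ => hFle j) (fun j _ => hFint j)
  refine ⟨g, hg, ?_, hint.trans ?_⟩
  · filter_upwards [hle] with data h
    rwa [M.posterior_eq β]
  · gcongr
    exact card_cellFinset_le (by omega)

end Stage

/-! ### Explicit rates at a fixed sample size. -/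

section StageBounds

variable (M : GLM) {K r rbar : ℕ} (νx : Measure (Fin K → ℝ)) [IsProbabilityMeasure νx]
  (β : Fin K → ℝ) {V : (γ : Finset (Fin K)) → Matrix γ γ ℝ}

lemma GLM.one_le_D {R : ℝ} (hR : 0 ≤ R) : 1 ≤ M.D R := by
  rw [M.D_eq]
  have := mul_nonneg hR (M.slope_nonneg R)
  linarith

lemma exists_card_eq_tailSum (hr : r ≤ K) :
    ∃ γ : Finset (Fin K), γ.card = r ∧ ∑ j ∈ γᶜ, |β j| = tailSum β r := by
  obtain ⟨γ₁, -, hγ₁⟩ := Finset.exists_subset_card_eq (s := (Finset.univ : Finset (Fin K)))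
    (n := r) (by simpa using hr)
  have : Nonempty {γ : Finset (Fin K) // γ.card = r} := ⟨⟨γ₁, hγ₁⟩⟩
  obtain ⟨γ, hγ⟩ := exists_eq_ciInf_of_finite
    (f := fun γ : {γ : Finset (Fin K) // γ.card = r} => ∑ j ∈ γ.1ᶜ, |β j|)
  exact ⟨γ.1, γ.2, hγ⟩

/-- Take the model of size r that attains the tail sum. Coefficients within η/(2r) of the truth
contribute at most η/2 to the predictor error, and the omitted ones contribute the other half. -/
lemma le_prior_neighbourhood (hV : ∀ γ, γ.card ≤ rbar → (V γ).PosDef) (hr : 1 ≤ r) (hrK : r < K)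
    (hrb : r ≤ rbar) (hhalf : (r : ℝ) / K ≤ 1 / 2) {η L : ℝ} (hη : 0 < η) (hη1 : η ≤ 1)
    (htail : tailSum β r ≤ η / 2) (hL : ∑ j, |β j| ≤ L) :
    ∃ G : Set (Param K),
      ENNReal.ofReal (Real.exp (-(r * Real.log K + 4 * r + r * (Real.log (2 / η) +
        2 * Real.log r + |Real.log (supEig V r)|) + |supInvEig V r| * L ^ 2))) ≤
          prior r rbar V G ∧
      ∀ θ ∈ G, ∀ x : Fin K → ℝ, (∀ j, |x j| ≤ 1) → |lin x θ - ∑ j, x j * β j| ≤ η := by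
  obtain ⟨γ, hγ, hγt⟩ := exists_card_eq_tailSum β hrK.le
  have r1 : (1 : ℝ) ≤ r := by exact_mod_cast hr
  set h := η / (2 * r) with hh
  have h0 : 0 < h := by positivity
  refine ⟨{θ | θ.1 = γ ∧ ∀ j ∈ γ, |coef θ j - β j| ≤ h}, ?_, ?_⟩
  -- Raising the eigenvalue bound to at least 1 makes t at most 1 and keeps log b below the absolute
  -- logarithm. The choice of t makes b r t² ≤ h², using r b ≥ 1.
  · set b := max (supEig V r) 1 with hb
    have b1 : 1 ≤ b := le_max_right _ _
    have b0 : 0 < b := by linarith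
    set t := η / (2 * r ^ 2 * b) with ht
    have t0 : 0 < t := by positivity
    have t1 : t ≤ 1 := by
      rw [ht, div_le_one (by positivity)]
      nlinarith [mul_le_mul r1 b1 zero_le_one (by linarith)]
    have hcard : Fintype.card γ = r := by rw [Fintype.card_coe, hγ]
    set βγ : EuclideanSpace ℝ γ := WithLp.toLp 2 fun j => β j with hβγ
    have hcube := le_multivariateGaussian_cube (hV γ (hγ.le.trans hrb)) βγ (t := t) (η := h)
      (b := b) (B := |supInvEig V r|) t0.le t1 h0.le
      ((ch₁_le_supEig hγ).trans (le_max_left _ _))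
      ((ch₁_inv_le_supInvEig hγ).trans (le_abs_self _)) (by
        rw [hcard, ht, hh, div_pow, div_pow]
        rw [mul_div_assoc', mul_div_assoc', div_le_div_iff₀ (by positivity) (by positivity)]
        have : (1 : ℝ) ≤ r * b := by nlinarith
        have e1 : b * (r * η ^ 2) * (2 * r) ^ 2 = 4 * η ^ 2 * r ^ 3 * b := by ring
        have e2 : η ^ 2 * (2 * r ^ 2 * b) ^ 2 = 4 * η ^ 2 * r ^ 3 * b * (r * b) := by ring
        rw [e1, e2]
        exact le_mul_of_one_le_right (by positivity) this)
    rw [hcard] at hcube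
    have hnorm : ‖βγ‖ ^ 2 ≤ L ^ 2 := by
      rw [EuclideanSpace.real_norm_sq_eq]
      calc ∑ j : γ, βγ j ^ 2 = ∑ j : γ, |β j| ^ 2 := by simp [hβγ]
        _ ≤ (∑ j : γ, |β j|) ^ 2 := Finset.sum_sq_le_sq_sum_of_nonneg fun _ _ => abs_nonneg _
        _ ≤ L ^ 2 := by
          gcongr
          refine le_trans ?_ hL
          rw [Finset.sum_coe_sort γ (fun j => |β j|)]
          exact Finset.sum_le_sum_of_subset_of_nonneg (Finset.subset_univ _)
            fun _ _ _ => abs_nonneg _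
    have hlogb : Real.log b ≤ |Real.log (supEig V r)| := by
      rcases le_total (supEig V r) 1 with h | h
      · rw [hb, max_eq_right h, Real.log_one]; exact abs_nonneg _
      · rw [hb, max_eq_left h]; exact le_abs_self _
    have hpow : t ^ r = Real.exp (-(r * (Real.log (2 / η) + 2 * Real.log r + Real.log b))) := by
      rw [← Real.exp_log (pow_pos t0 r), Real.log_pow, ht, Real.log_div hη.ne' (by positivity),
        Real.log_div two_ne_zero hη.ne', Real.log_mul (by positivity) b0.ne',
        Real.log_mul two_ne_zero (by positivity), Real.log_pow]
      congr 1
      push_cast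
      ring
    refine le_trans ?_ (le_prior_cube (γ := γ) β h)
    refine le_trans ?_ (mul_le_mul' (ENNReal.ofReal_le_ofReal
      (exp_le_modelPrior hr hrK hrb hhalf hγ)) hcube)
    rw [← ENNReal.ofReal_mul (Real.exp_pos _).le, hpow, ← Real.exp_add, ← Real.exp_add]
    apply ENNReal.ofReal_le_ofReal
    apply Real.exp_le_exp.2
    have q1 := mul_le_mul_of_nonneg_left hlogb (by positivity : (0 : ℝ) ≤ r)
    have q2 := mul_le_mul_of_nonneg_left hnorm (abs_nonneg (supInvEig V r))
    nlinarith
  · rintro θ ⟨hθ, hclose⟩ x hx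
    refine (abs_lin_sub_le hx θ β).trans ?_
    rw [← Finset.sum_add_sum_compl γ]
    have s1 : ∑ j ∈ γ, |coef θ j - β j| ≤ η / 2 := by
      calc _ ≤ γ.card • h := Finset.sum_le_card_nsmul _ _ _ hclose
        _ = η / 2 := by rw [hγ, nsmul_eq_mul, hh]; field_simp
    have s2 : ∑ j ∈ γᶜ, |coef θ j - β j| = tailSum β r := by
      rw [← hγt]
      refine Finset.sum_congr rfl fun j hj => ?_
      rw [coef_of_notMem (by rw [hθ]; exact Finset.mem_compl.1 hj), zero_sub, abs_neg]
    linarith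

/-- The posterior mass far from the truth has a majorant of exponentially small expectation, when
the prior mass near the truth, the number of cells and the model size are suitably bounded. -/
lemma exists_posterior_far_majorant_exp (n : ℕ) (hx : ∀ᵐ x ∂νx, ∀ j, |x j| ≤ 1)
    (hV : ∀ γ, γ.card ≤ rbar → (V γ).PosDef)
    (hr : 1 ≤ r) (hrb : r ≤ rbar) (hrK : rbar < K) {ε : ℝ} (hε : 0 < ε) (hε1 : ε ≤ 1)
    {C : ℝ} (hC : C = √(n * ε ^ 2 * supEigLe V rbar)) (hn : 0 < n)
    {N : ℕ} (hN : 1024 * M.D (rbar * C) / ε ^ 4 ≤ N)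
    (hcount : ((K : ℝ) + 1) * (K * (N + 1)) ^ rbar ≤ Real.exp (n * ε ^ 2 / 16))
    (hrexp : (rbar : ℝ) * 2 ≤ Real.exp (n * ε ^ 2 / 16))
    {G : Set (Param K)} (hG : ENNReal.ofReal (Real.exp (-(n * ε ^ 2 / 32))) ≤ prior r rbar V G)
    (hA : ∀ θ ∈ G, ∫⁻ z, (M.ratio β z θ)⁻¹ ∂(M.trueLaw νx β) ≤
      ENNReal.ofReal (Real.exp (ε ^ 2 / 32))) :
    ∃ g : (Fin n → Obs K) → ℝ≥0∞, Measurable g ∧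
      (∀ᵐ data ∂(M.dataLaw νx β n), M.posterior (prior r rbar V) data
        {θ | ε < M.hellinger νx β θ} ≤ g data) ∧
      ∫⁻ data, g data ∂(M.dataLaw νx β n) ≤
        ENNReal.ofReal (3 * Real.exp (-(n * ε ^ 2 / 32))) := by
  set u := n * ε ^ 2 with hu
  have n0 : (0 : ℝ) < n := by exact_mod_cast hn
  have u0 : 0 < u := by positivity
  have B0 : 0 < supEigLe V rbar := supEigLe_pos (hr.trans hrb) (by omega) hV
  have C0 : 0 < C := by rw [hC]; positivity
  have D1 : 1 ≤ M.D (rbar * C) := M.one_le_D (by positivity)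
  have N0 : (0 : ℝ) < N := lt_of_lt_of_le (by positivity) hN
  have hGne : prior r rbar V G ≠ 0 :=
    (lt_of_lt_of_le (ENNReal.ofReal_pos.2 (Real.exp_pos _)) hG).ne'
  -- Since rbar C times the slope is `M.D (rbar * C)` - 1, the cell condition becomes a lower bound
  -- on N in terms of D/ε⁴.
  have hcell : rbar * (2 * C / N) * M.slope (rbar * C) ≤ ε ^ 4 / 512 := by
    have e : rbar * (2 * C / N) * M.slope (rbar * C) = 2 * (M.D (rbar * C) - 1) / N := by
      rw [M.D_eq]; field_simp; ring
    rw [e, div_le_iff₀ N0]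
    rw [div_le_iff₀ (by positivity)] at hN
    linarith
  -- The factor m = exp(-u/16) balances the terms: m Aⁿ becomes exp(-u/32), while the inverse
  -- evidence costs only exp(3u/32), and half that exponent in the cell term, against the gain
  -- exp(-u/4).
  obtain ⟨g, hg, hle, hint⟩ := exists_posterior_far_majorant M νx β n hx hr (hrb.trans_lt hrK) hε
    hε1 C0 (by exact_mod_cast N0) hcell hGne (m := ENNReal.ofReal (Real.exp (-(u / 16))))
    (ENNReal.ofReal_pos.2 (Real.exp_pos _)).ne' ENNReal.ofReal_ne_top hA
  refine ⟨g, hg, hle, hint.trans ?_⟩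
  set T := (ENNReal.ofReal (Real.exp (-(u / 16))) * prior r rbar V G)⁻¹ with hT
  have hTle : T ≤ ENNReal.ofReal (Real.exp (3 * u / 32)) := by
    calc T ≤ (ENNReal.ofReal (Real.exp (-(u / 16))) *
          ENNReal.ofReal (Real.exp (-(u / 32))))⁻¹ := by rw [hT]; gcongr
      _ = _ := by
        rw [← ENNReal.ofReal_mul (Real.exp_pos _).le, ← Real.exp_add,
          ← ENNReal.ofReal_inv_of_pos (Real.exp_pos _), ← Real.exp_neg]
        congr 2
        ring
  have hThalf : T ^ (1 / 2 : ℝ) ≤ ENNReal.ofReal (Real.exp (3 * u / 64)) := by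
    calc _ ≤ ENNReal.ofReal (Real.exp (3 * u / 32)) ^ (1 / 2 : ℝ) :=
          ENNReal.rpow_le_rpow hTle (by norm_num)
      _ = _ := by
        rw [ENNReal.ofReal_rpow_of_pos (Real.exp_pos _), ← Real.exp_mul]
        congr 2
        ring
  have hoff := prior_offSieve_le (r := r) hr (hrb.trans_lt hrK) hV C0.le
  -- The radius C was chosen so that the Gaussian tail exponent is u/2 whatever the prior scale.
  have hCsq : C ^ 2 / (2 * supEigLe V rbar) = u / 2 := by
    rw [hC, Real.sq_sqrt (by positivity)]
    field_simp
  rw [hCsq] at hoff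
  have pow_exp : ∀ c : ℝ, ENNReal.ofReal (Real.exp (c * ε ^ 2)) ^ n =
      ENNReal.ofReal (Real.exp (c * u)) := by
    intro c
    rw [← ENNReal.ofReal_pow (Real.exp_pos _).le, ← Real.exp_nat_mul, hu]
    congr 2
    ring
  have t1 : ENNReal.ofReal (Real.exp (-(u / 16))) * ENNReal.ofReal (Real.exp (ε ^ 2 / 32)) ^ n =
      ENNReal.ofReal (Real.exp (-(u / 32))) := by
    rw [show ε ^ 2 / 32 = (1 / 32) * ε ^ 2 by ring, pow_exp,
      ← ENNReal.ofReal_mul (Real.exp_pos _).le, ← Real.exp_add]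
    congr 2
    ring
  have t2 : (((K + 1) * (K * (N + 1)) ^ rbar : ℕ) : ℝ≥0∞) *
      (T ^ (1 / 2 : ℝ) * ENNReal.ofReal (Real.exp (-(ε ^ 2 / 4))) ^ n) ≤
        ENNReal.ofReal (Real.exp (-(u / 32))) := by
    have hc : (((K + 1) * (K * (N + 1)) ^ rbar : ℕ) : ℝ≥0∞) ≤
        ENNReal.ofReal (Real.exp (u / 16)) := by
      rw [← ENNReal.ofReal_natCast]
      apply ENNReal.ofReal_le_ofReal
      push_cast
      exact hcount
    calc _ ≤ ENNReal.ofReal (Real.exp (u / 16)) * (ENNReal.ofReal (Real.exp (3 * u / 64)) *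
          ENNReal.ofReal (Real.exp (-(1 / 4) * u))) := by
          rw [show -(ε ^ 2 / 4) = -(1 / 4) * ε ^ 2 by ring, pow_exp]
          gcongr
      _ = ENNReal.ofReal (Real.exp (u / 16 + (3 * u / 64 + -(1 / 4) * u))) := by
          rw [← ENNReal.ofReal_mul (Real.exp_pos _).le, ← ENNReal.ofReal_mul (Real.exp_pos _).le,
            ← Real.exp_add, ← Real.exp_add]
      _ ≤ _ := by
          apply ENNReal.ofReal_le_ofReal
          apply Real.exp_le_exp.2
          linarith
  have t3 : T * prior r rbar V (offSieve K rbar C) ≤ ENNReal.ofReal (Real.exp (-(u / 32))) := by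
    calc _ ≤ ENNReal.ofReal (Real.exp (3 * u / 32)) *
          ENNReal.ofReal (rbar * (2 * Real.exp (-(u / 2)))) := by gcongr
      _ = ENNReal.ofReal (Real.exp (3 * u / 32) * (rbar * 2 * Real.exp (-(u / 2)))) := by
          rw [← ENNReal.ofReal_mul (Real.exp_pos _).le, mul_assoc (rbar : ℝ)]
      _ ≤ ENNReal.ofReal (Real.exp (3 * u / 32) * (Real.exp (u / 16) * Real.exp (-(u / 2)))) := by
          apply ENNReal.ofReal_le_ofReal
          gcongr
      _ ≤ _ := by
          apply ENNReal.ofReal_le_ofReal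
          rw [← Real.exp_add, ← Real.exp_add]
          apply Real.exp_le_exp.2
          linarith
  rw [t1]
  calc _ ≤ ENNReal.ofReal (Real.exp (-(u / 32))) + (ENNReal.ofReal (Real.exp (-(u / 32))) +
        ENNReal.ofReal (Real.exp (-(u / 32)))) := by gcongr
    _ = _ := by
      rw [← ENNReal.ofReal_add (Real.exp_pos _).le (Real.exp_pos _).le,
        ← ENNReal.ofReal_add (Real.exp_pos _).le (by positivity)]
      congr 1
      ring

/-- N + 1 is at most 2¹¹ D/ε⁴, and powers of 2 are absorbed into K ≥ 2. The coefficient 14 is 11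
from these, 1 from the choice of model and 2 from the factor K + 1. -/
lemma count_le_exp {K rbar N : ℕ} {ε D E : ℝ} (hK : 2 ≤ K) (hrbar : 1 ≤ rbar) (hε : 0 < ε)
    (hε1 : ε ≤ 1) (hD : 1 ≤ D) (hN : (N : ℝ) ≤ 1024 * D / ε ^ 4 + 1)
    (hE : 14 * (rbar * Real.log K) + rbar * Real.log D + 2 * (rbar * Real.log (1 / ε ^ 2)) ≤ E) :
    ((K : ℝ) + 1) * (K * (N + 1)) ^ rbar ≤ Real.exp E := by
  have K2 : (2 : ℝ) ≤ K := by exact_mod_cast hK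
  have r1 : (1 : ℝ) ≤ rbar := by exact_mod_cast hrbar
  have hlogK : 0 ≤ Real.log K := Real.log_nonneg (by linarith)
  have hN1 : (N : ℝ) + 1 ≤ 2 ^ 11 * D * (1 / ε ^ 2) ^ 2 := by
    have e4 : ε ^ 4 ≤ 1 := pow_le_one₀ hε.le hε1
    have : (1 : ℝ) ≤ D / ε ^ 4 := by
      rw [one_le_div (by positivity)]; linarith
    have e : 2 ^ 11 * D * (1 / ε ^ 2) ^ 2 = 2048 * (D / ε ^ 4) := by field_simp; norm_num
    rw [e]
    rw [mul_div_assoc] at hN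
    linarith
  have hlogN : Real.log (N + 1) ≤ 11 * Real.log K + Real.log D + 2 * Real.log (1 / ε ^ 2) := by
    have := Real.log_le_log (by positivity) hN1
    rw [Real.log_mul (by positivity) (by positivity), Real.log_mul (by positivity) (by positivity),
      Real.log_pow, Real.log_pow] at this
    push_cast at this
    linarith [Real.log_le_log two_pos K2]
  have hlogK1 : Real.log (K + 1) ≤ 2 * Real.log K := by
    have : Real.log ((K : ℝ) + 1) ≤ Real.log ((K : ℝ) ^ 2) :=
      Real.log_le_log (by positivity) (by nlinarith)
    rwa [Real.log_pow] at this
  rw [← Real.log_le_iff_le_exp (by positivity), Real.log_mul (by positivity) (by positivity),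
    Real.log_pow, Real.log_mul (by positivity) (by positivity)]
  refine le_trans ?_ hE
  nlinarith [mul_le_mul_of_nonneg_left hlogN (by linarith : (0 : ℝ) ≤ rbar)]

end StageBounds

/-! ### From the rate conditions to eventual bounds. -/

section Asymptotics

lemma Prec.eventually_le {v u : ℕ → ℝ} (h : Prec v u) (hu : ∀ᶠ n in atTop, 0 < u n) {c : ℝ}
    (hc : 0 < c) : ∀ᶠ n in atTop, |v n| ≤ c * u n := by
  have := (tendsto_order.1 h.abs).2 c (by simpa using hc)
  filter_upwards [this, hu] with n hn hun
  rw [abs_div, abs_of_pos hun, div_lt_iff₀ hun] at hn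
  exact hn.le

lemma tendsto_atTop_of_prec_one {u : ℕ → ℝ} (h : Prec (fun _ => 1) u)
    (hu : ∀ᶠ n in atTop, 0 < u n) : Tendsto u atTop atTop := by
  rw [tendsto_atTop]
  intro b
  have hb : 0 < max b 1 := lt_of_lt_of_le one_pos (le_max_right _ _)
  filter_upwards [h.eventually_le hu (c := (max b 1)⁻¹) (by positivity)] with n hn
  rw [abs_one, inv_mul_eq_div, le_div_iff₀ hb, one_mul] at hn
  exact (le_max_left _ _).trans hn

variable (M : GLM) {K r rbar : ℕ → ℕ} {ε : ℕ → ℝ}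
  {νx : ∀ n, Measure (Fin (K n) → ℝ)} [∀ n, IsProbabilityMeasure (νx n)]
  {β : ∀ n, Fin (K n) → ℝ}
  {V : ∀ n, (γ : Finset (Fin (K n))) → Matrix γ γ ℝ}

/-- Under the rate conditions, the posterior mass outside the Hellinger ball of radius `ε n` has
eventually a measurable majorant whose expectation is exponentially small in `n ε²`. -/
lemma eventually_exists_majorant
    (hV : ∀ n γ, γ.card ≤ rbar n → (V n γ).PosDef)
    (hx : ∀ n, ∀ᵐ x ∂(νx n), ∀ j, |x j| ≤ 1)
    (hβ : ∃ L : ℝ, Tendsto (fun n => ∑ j, |β n j|) atTop (𝓝 L))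
    (hε : ∀ n, ε n ∈ Set.Ioc (0 : ℝ) 1)
    (hu : Tendsto (fun n => n * ε n ^ 2) atTop atTop)
    (h2 : Prec (fun n => rbar n * Real.log (1 / ε n ^ 2)) (fun n => n * ε n ^ 2))
    (h3 : Prec (fun n => rbar n * Real.log (K n)) (fun n => n * ε n ^ 2))
    (h4 : Prec
      (fun n => rbar n *
        Real.log (M.D (rbar n * Real.sqrt (n * ε n ^ 2 * supEigLe (V n) (rbar n)))))
      (fun n => n * ε n ^ 2))
    (h5 : ∀ n, 1 ≤ r n ∧ r n ≤ rbar n ∧ rbar n < K n)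
    (h6 : Prec (fun n => r n) (fun n => K n))
    (h7 : Prec (fun n => tailSum (β n) (r n)) (fun n => ε n ^ 2))
    (h8 : Prec (fun n => supInvEig (V n) (r n)) (fun n => n * ε n ^ 2))
    (h9 : Prec (fun n => r n * Real.log (supEig (V n) (r n))) (fun n => n * ε n ^ 2)) :
    ∀ᶠ n : ℕ in atTop, ∃ g : (Fin n → Obs (K n)) → ℝ≥0∞, Measurable g ∧
      (∀ᵐ data ∂(M.dataLaw (νx n) (β n) n), M.posterior (prior (r n) (rbar n) (V n)) data
        {θ | ε n < M.hellinger (νx n) (β n) θ} ≤ g data) ∧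
      ∫⁻ data, g data ∂(M.dataLaw (νx n) (β n) n) ≤
        ENNReal.ofReal (Real.exp (-(1 / 64 * (n * ε n ^ 2)))) := by
  obtain ⟨L, hL⟩ := hβ
  -- Eventually the ℓ¹ norm of β* is at most L + 1, which bounds the true predictors because |x j| ≤
  -- 1.
  obtain ⟨Cχ, ηχ, Cχ0, ηχ0, hχ⟩ := M.exists_chiSq_le (L + 1)
  -- The neighbourhood has predictor radius κε². The three bounds keep it at most 1, inside the
  -- range of the chi-square estimate, and with chi-square exponent at most ε²/32.
  set κ := min (min 1 ηχ) (1 / (32 * Cχ)) with hκ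
  have κ0 : 0 < κ := by positivity
  have κ1 : κ ≤ 1 := (min_le_left _ _).trans (min_le_left _ _)
  have κη : κ ≤ ηχ := (min_le_left _ _).trans (min_le_right _ _)
  have κC : Cχ * κ ≤ 1 / 32 := by
    calc Cχ * κ ≤ Cχ * (1 / (32 * Cχ)) := by gcongr; exact min_le_right _ _
      _ = 1 / 32 := by field_simp
  -- This collects the multiples of q = rbar log K in the prior exponent: 1 from r log K, 8 from 4r,
  -- 2 from 2r log r, and 2 log(2/κ) from r log(2/κ). It uses r ≤ 2q, which comes from log K ≥ 1/2.
  set c₀ := 11 + 2 * Real.log (2 / κ) with hc₀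
  have hlogκ : 0 ≤ Real.log (2 / κ) :=
    Real.log_nonneg (by rw [le_div_iff₀ κ0]; linarith)
  have c₀0 : 0 < c₀ := by positivity
  have upos : ∀ᶠ n : ℕ in atTop, 0 < (n : ℝ) * ε n ^ 2 := hu.eventually_gt_atTop 0
  have Kpos : ∀ᶠ n : ℕ in atTop, (0 : ℝ) < K n :=
    Eventually.of_forall fun n => by
      have := h5 n
      exact_mod_cast (by omega : 0 < K n)
  have εpos : ∀ᶠ n : ℕ in atTop, 0 < ε n ^ 2 :=
    Eventually.of_forall fun n => pow_pos (hε n).1 2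
  filter_upwards [eventually_gt_atTop 0, upos, hu.eventually_ge_atTop (64 * Real.log 3),
    hL.eventually_le_const (lt_add_one L),
    h2.eventually_le upos (c := 1 / 256) (by norm_num),
    h3.eventually_le upos (c := 1 / 1024) (by norm_num),
    h3.eventually_le upos (c := 1 / (128 * c₀)) (by positivity),
    h4.eventually_le upos (c := 1 / 128) (by norm_num),
    h6.eventually_le Kpos (c := 1 / 2) (by norm_num),
    h7.eventually_le εpos (c := κ / 2) (by positivity),
    h8.eventually_le upos (c := 1 / (128 * ((L + 1) ^ 2 + 1))) (by positivity),
    h9.eventually_le upos (c := 1 / 128) (by norm_num)]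
    with n hn u0 hu3 hLn e2 e3 e3' e4 e6 e7 e8 e9
  obtain ⟨hr, hrb, hrK⟩ := h5 n
  obtain ⟨ε0, ε1⟩ := hε n
  set u := (n : ℝ) * ε n ^ 2 with hudef
  have K2 : 2 ≤ K n := by omega
  have K2' : (2 : ℝ) ≤ K n := by exact_mod_cast K2
  have r1 : (1 : ℝ) ≤ r n := by exact_mod_cast hr
  have rrb : (r n : ℝ) ≤ rbar n := by exact_mod_cast hrb
  have rK : (r n : ℝ) ≤ K n := by exact_mod_cast (by omega : r n ≤ K n)
  have rbK : (rbar n : ℝ) ≤ K n := by exact_mod_cast hrK.le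
  have hlogK : 1 / 2 ≤ Real.log (K n) := by
    have := Real.log_le_log two_pos K2'
    linarith [Real.log_two_gt_d9]
  have hε2 : ε n ^ 2 ≤ 1 := pow_le_one₀ ε0.le ε1
  have hlogε : 0 ≤ Real.log (1 / ε n ^ 2) :=
    Real.log_nonneg (by rw [le_div_iff₀ (by positivity), one_mul]; exact hε2)
  have e2 := (le_abs_self _).trans e2
  have e3 := (le_abs_self _).trans e3
  have e3' := (le_abs_self _).trans e3'
  have e4 := (le_abs_self _).trans e4
  have e7 := (le_abs_self _).trans e7
  rw [abs_of_nonneg (by positivity)] at e6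
  set C := √(u * supEigLe (V n) (rbar n)) with hC
  have D1 : 1 ≤ M.D (rbar n * C) := M.one_le_D (by positivity)
  obtain ⟨G, hGle, hGclose⟩ := le_prior_neighbourhood (β n) (hV n) hr (hrb.trans_lt hrK) hrb
    (by rw [div_le_iff₀ (by linarith)]; exact e6) (η := κ * ε n ^ 2) (L := L + 1) (by positivity)
    (mul_le_one₀ κ1 (sq_nonneg _) hε2) (by linarith) hLn
  -- The exponent splits into three parts of at most u/128 and one of at most u/256, together below
  -- u/32.
  have hG : ENNReal.ofReal (Real.exp (-(u / 32))) ≤ prior (r n) (rbar n) (V n) G := by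
    refine le_trans (ENNReal.ofReal_le_ofReal (Real.exp_le_exp.2 (neg_le_neg ?_))) hGle
    set q := rbar n * Real.log (K n) with hq
    have q1 : (r n : ℝ) * Real.log (K n) ≤ q := by rw [hq]; gcongr
    have q2 : (r n : ℝ) ≤ 2 * q := by
      have := mul_le_mul_of_nonneg_left hlogK (by positivity : (0 : ℝ) ≤ rbar n)
      linarith
    have q3 : (r n : ℝ) * Real.log (r n) ≤ q := by
      refine le_trans ?_ q1
      gcongr
    have q4 : Real.log (2 / (κ * ε n ^ 2)) = Real.log (2 / κ) + Real.log (1 / ε n ^ 2) := by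
      rw [← Real.log_mul (by positivity) (by positivity)]
      congr 1
      field_simp
    have q5 : (r n : ℝ) * Real.log (1 / ε n ^ 2) ≤ u / 256 := by
      refine le_trans (mul_le_mul_of_nonneg_right rrb hlogε) ?_
      linarith
    have q6 : (r n : ℝ) * |Real.log (supEig (V n) (r n))| ≤ u / 128 := by
      rw [abs_mul, abs_of_nonneg (by positivity : (0 : ℝ) ≤ r n)] at e9
      linarith
    have q7 : |supInvEig (V n) (r n)| * (L + 1) ^ 2 ≤ u / 128 := by
      calc _ ≤ 1 / (128 * ((L + 1) ^ 2 + 1)) * u * ((L + 1) ^ 2 + 1) := by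
            gcongr
            linarith
        _ = u / 128 := by field_simp
    have q8 : c₀ * q ≤ u / 128 := by
      calc c₀ * q ≤ c₀ * (1 / (128 * c₀) * u) := by gcongr
        _ = u / 128 := by field_simp
    have q9 : (r n : ℝ) * Real.log (2 / κ) ≤ 2 * q * Real.log (2 / κ) := by gcongr
    rw [q4]
    have : c₀ * q = 11 * q + 2 * q * Real.log (2 / κ) := by rw [hc₀]; ring
    linarith
  have hA : ∀ θ ∈ G, ∫⁻ z, (M.ratio (β n) z θ)⁻¹ ∂(M.trueLaw (νx n) (β n)) ≤
      ENNReal.ofReal (Real.exp (ε n ^ 2 / 32)) := by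
    intro θ hθ
    apply M.lintegral_ratio_inv_le
    filter_upwards [hx n] with x hxb
    refine (hχ _ _ (κ * ε n ^ 2) ((abs_sum_mul_le hxb _).trans hLn) ?_
      (hGclose θ hθ x hxb)).trans ?_
    · exact (mul_le_of_le_one_right κ0.le hε2).trans κη
    · apply ENNReal.ofReal_le_ofReal
      apply Real.exp_le_exp.2
      have := mul_le_mul_of_nonneg_right κC (sq_nonneg (ε n))
      linarith
  -- The rate bounds add up to (14 + 8 + 8)u/1024, below the allowance u/16.
  have hcount := count_le_exp (K := K n) (rbar := rbar n)
    (N := ⌈1024 * M.D (rbar n * C) / ε n ^ 4⌉₊) (E := u / 16) K2 (hr.trans hrb) ε0 ε1 D1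
    (Nat.ceil_lt_add_one (by positivity)).le (by linarith)
  have hrexp : (rbar n : ℝ) * 2 ≤ Real.exp (u / 16) := by
    have rb1 : (1 : ℝ) ≤ rbar n := r1.trans rrb
    rw [← Real.log_le_iff_le_exp (by positivity), Real.log_mul (by positivity) two_ne_zero]
    have := Real.log_le_log two_pos K2'
    have := Real.log_le_log (by positivity) rbK
    have := mul_le_mul_of_nonneg_right rb1 (by linarith : 0 ≤ Real.log (K n))
    linarith
  obtain ⟨g, hg, hle, hint⟩ := exists_posterior_far_majorant_exp M (νx n) (β n) n (hx n) (hV n) hr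
    hrb hrK ε0 ε1 hC hn (Nat.le_ceil _) hcount hrexp hG hA
  refine ⟨g, hg, hle, hint.trans (ENNReal.ofReal_le_ofReal ?_)⟩
  have h3 : (3 : ℝ) ≤ Real.exp (u / 64) := by
    rw [← Real.log_le_iff_le_exp (by norm_num)]
    linarith
  calc 3 * Real.exp (-(u / 32)) ≤ Real.exp (u / 64) * Real.exp (-(u / 32)) := by gcongr
    _ = _ := by rw [← Real.exp_add]; congr 1; ring

end Asymptotics

/-! ### From a majorant of small expectation to probability statements. -/

section Conclusions

variable (M : GLM) {K r rbar n : ℕ} {νx : Measure (Fin K → ℝ)}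
  {β : Fin K → ℝ} {V : (γ : Finset (Fin K)) → Matrix γ γ ℝ}

/-- Markov's inequality, spending half of the exponent on the threshold and keeping half for the
probability. -/
lemma dataLaw_posterior_ge_le {g : (Fin n → Obs K) → ℝ≥0∞} (hg : Measurable g)
    {π : Measure (Param K)} {B : Set (Param K)}
    (hle : ∀ᵐ data ∂(M.dataLaw νx β n), M.posterior π data B ≤ g data) {s : ℝ}
    (hint : ∫⁻ data, g data ∂(M.dataLaw νx β n) ≤ ENNReal.ofReal (Real.exp (-(s + s)))) :
    M.dataLaw νx β n {data | ENNReal.ofReal (Real.exp (-s)) ≤ M.posterior π data B} ≤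
      ENNReal.ofReal (Real.exp (-s)) := by
  calc _ ≤ M.dataLaw νx β n {data | ENNReal.ofReal (Real.exp (-s)) ≤ g data} := by
        apply measure_mono_ae
        filter_upwards [hle] with data h h'
        exact le_trans h' h
    _ ≤ (∫⁻ data, g data ∂(M.dataLaw νx β n)) / ENNReal.ofReal (Real.exp (-s)) :=
        meas_ge_le_lintegral_div hg.aemeasurable (ENNReal.ofReal_pos.2 (Real.exp_pos _)).ne'
          ENNReal.ofReal_ne_top
    _ ≤ ENNReal.ofReal (Real.exp (-(s + s))) / ENNReal.ofReal (Real.exp (-s)) := by gcongr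
    _ = _ := by
        rw [← ENNReal.ofReal_div_of_pos (Real.exp_pos _), ← Real.exp_sub]
        congr 2
        ring

variable [IsProbabilityMeasure νx]

instance : IsProbabilityMeasure (M.dataLaw νx β n) := by unfold GLM.dataLaw; infer_instance

/-- The posterior almost surely has total mass 1, so either `B` carries at least 1 - e or its
complement at least e. Only subadditivity is used, hence `B` need not be measurable. -/
lemma one_sub_le_dataLaw_posterior_ge (hr : 1 ≤ r) (hrK : r < K) {B : Set (Param K)} {e : ℝ}
    {p : ℝ≥0∞} (he : 0 ≤ e)
    (h : M.dataLaw νx β n {data | ENNReal.ofReal e ≤ M.posterior (prior r rbar V) data Bᶜ} ≤ p) :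
    1 - p ≤ M.dataLaw νx β n
      {data | ENNReal.ofReal (1 - e) ≤ M.posterior (prior r rbar V) data B} := by
  have := isProbabilityMeasure_prior (V := V) (rbar := rbar) hr hrK
  rw [tsub_le_iff_right]
  calc (1 : ℝ≥0∞) = M.dataLaw νx β n Set.univ := measure_univ.symm
    _ ≤ M.dataLaw νx β n
        ({data | ENNReal.ofReal (1 - e) ≤ M.posterior (prior r rbar V) data B} ∪
          {data | ENNReal.ofReal e ≤ M.posterior (prior r rbar V) data Bᶜ}) := by
        apply measure_mono_ae
        filter_upwards [M.ae_lintegral_ratio_ne_top νx β (prior r rbar V)] with data hd _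
        have htot := M.posterior_univ β (prior r rbar V) data hd
        rw [← Set.union_compl_self B] at htot
        have hsub := htot.symm.le.trans (measure_union_le B Bᶜ)
        by_cases hc : ENNReal.ofReal e ≤ M.posterior (prior r rbar V) data Bᶜ
        · exact Or.inr hc
        · left
          change ENNReal.ofReal (1 - e) ≤ _
          rw [ENNReal.ofReal_sub _ he, ENNReal.ofReal_one, tsub_le_iff_right]
          exact hsub.trans (by gcongr; exact (not_le.1 hc).le)
    _ ≤ _ := (measure_union_le _ _).trans (by gcongr)

end Conclusions

end BVS

end

theorem theorem1 (M : BVS.GLM) (K r rbar : ℕ → ℕ) (ε : ℕ → ℝ)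
    (νx : ∀ n, Measure (Fin (K n) → ℝ)) [∀ n, IsProbabilityMeasure (νx n)]
    (β : ∀ n, Fin (K n) → ℝ)
    (V : ∀ n, (γ : Finset (Fin (K n))) → Matrix γ γ ℝ)
    (hV : ∀ n γ, γ.card ≤ rbar n → (V n γ).PosDef)
    (hx : ∀ n, ∀ᵐ x ∂(νx n), ∀ j, |x j| ≤ 1)
    (hK : Monotone K)
    (hβ : ∃ L : ℝ, Tendsto (fun n => ∑ j, |β n j|) atTop (𝓝 L))
    (hε : ∀ n, ε n ∈ Set.Ioc (0 : ℝ) 1)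
    (h1 : BVS.Prec (fun _ => 1) (fun n => n * ε n ^ 2))
    (h2 : BVS.Prec (fun n => rbar n * Real.log (1 / ε n ^ 2)) (fun n => n * ε n ^ 2))
    (h3 : BVS.Prec (fun n => rbar n * Real.log (K n)) (fun n => n * ε n ^ 2))
    (h4 : BVS.Prec
      (fun n => rbar n *
        Real.log (M.D (rbar n * Real.sqrt (n * ε n ^ 2 * BVS.supEigLe (V n) (rbar n)))))
      (fun n => n * ε n ^ 2))
    (h5 : ∀ n, 1 ≤ r n ∧ r n ≤ rbar n ∧ rbar n < K n)
    (h6 : BVS.Prec (fun _ => 1) (fun n => r n) ∧ BVS.Prec (fun n => r n) (fun n => K n))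
    (h7 : BVS.Prec (fun n => BVS.tailSum (β n) (r n)) (fun n => ε n ^ 2))
    (h8 : BVS.Prec (fun n => BVS.supInvEig (V n) (r n)) (fun n => n * ε n ^ 2))
    (h9 : BVS.Prec (fun n => r n * Real.log (BVS.supEig (V n) (r n)))
      (fun n => n * ε n ^ 2)) :
    (∃ r₀ : ℝ, 0 < r₀ ∧
      Tendsto
        (fun n => M.dataLaw (νx n) (β n) n
          {data | ENNReal.ofReal (1 - Real.exp (-r₀ * n * ε n ^ 2)) ≤
            M.posterior (BVS.prior (r n) (rbar n) (V n)) data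
              {θ | M.hellinger (νx n) (β n) θ ≤ ε n}})
        atTop (𝓝 1)) ∧
    (∃ c₁ : ℝ, 0 < c₁ ∧ ∀ᶠ n : ℕ in atTop,
      M.dataLaw (νx n) (β n) n
          {data | ENNReal.ofReal (Real.exp (-0.5 * c₁ * n * ε n ^ 2)) ≤
            M.posterior (BVS.prior (r n) (rbar n) (V n)) data
              {θ | ε n < M.hellinger (νx n) (β n) θ}} ≤
        ENNReal.ofReal (Real.exp (-0.5 * c₁ * n * ε n ^ 2))) ∧
    (∃ c₁ : ℝ, 0 < c₁ ∧ ∀ᶠ n : ℕ in atTop,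
      ∫⁻ data, M.posterior (BVS.prior (r n) (rbar n) (V n)) data
          {θ | ε n < M.hellinger (νx n) (β n) θ} ∂(M.dataLaw (νx n) (β n) n) ≤
        ENNReal.ofReal (Real.exp (-c₁ * n * ε n ^ 2))) := by
  have upos : ∀ᶠ n : ℕ in atTop, 0 < (n : ℝ) * ε n ^ 2 := by
    filter_upwards [eventually_gt_atTop 0] with n hn
    have := (hε n).1
    positivity
  have hu := BVS.tendsto_atTop_of_prec_one h1 upos
  have key := BVS.eventually_exists_majorant M hV hx hβ hε hu h2 h3 h4 h5 h6.2 h7 h8 h9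
  have large : ∀ᶠ n : ℕ in atTop, M.dataLaw (νx n) (β n) n
      {data | ENNReal.ofReal (Real.exp (-(1 / 128 * (n * ε n ^ 2)))) ≤
        M.posterior (BVS.prior (r n) (rbar n) (V n)) data
          {θ | ε n < M.hellinger (νx n) (β n) θ}} ≤
        ENNReal.ofReal (Real.exp (-(1 / 128 * (n * ε n ^ 2)))) := by
    filter_upwards [key] with n ⟨g, hg, hle, hint⟩
    refine BVS.dataLaw_posterior_ge_le M hg hle (hint.trans_eq ?_)
    congr 2
    ring
  -- The expectation bound has rate 1/64; Markov's inequality halves it to 1/128, which is 0.5 c₁ in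
  -- the second conclusion and r₀ in the first.
  refine ⟨⟨1 / 128, by norm_num, ?_⟩, ⟨1 / 64, by norm_num, ?_⟩, ⟨1 / 64, by norm_num, ?_⟩⟩
  · have lim : Tendsto (fun n : ℕ => 1 - ENNReal.ofReal (Real.exp (-(1 / 128 * (n * ε n ^ 2)))))
        atTop (𝓝 1) := by
      have h0 : Tendsto (fun n : ℕ => Real.exp (-(1 / 128 * (n * ε n ^ 2)))) atTop (𝓝 0) :=
        Real.tendsto_exp_neg_atTop_nhds_zero.comp (hu.const_mul_atTop (by norm_num))
      have h0' := ENNReal.Tendsto.sub (tendsto_const_nhds (x := (1 : ℝ≥0∞)))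
        (ENNReal.tendsto_ofReal h0) (Or.inl ENNReal.one_ne_top)
      simpa using h0'
    refine tendsto_of_tendsto_of_tendsto_of_le_of_le' lim tendsto_const_nhds ?_
      (Eventually.of_forall fun n => prob_le_one)
    filter_upwards [large] with n hn
    have hset : {θ | ε n < M.hellinger (νx n) (β n) θ} =
        {θ | M.hellinger (νx n) (β n) θ ≤ ε n}ᶜ := by
      ext θ
      simp
    rw [hset] at hn
    rw [show -(1 / 128) * n * ε n ^ 2 = -(1 / 128 * (n * ε n ^ 2)) by ring]
    exact BVS.one_sub_le_dataLaw_posterior_ge M (h5 n).1 ((h5 n).2.1.trans_lt (h5 n).2.2)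
      (Real.exp_pos _).le hn
  · filter_upwards [large] with n hn
    rwa [show -(1 / 128 * (n * ε n ^ 2)) = -0.5 * (1 / 64) * n * ε n ^ 2 by norm_num; ring] at hn
  · filter_upwards [key] with n ⟨g, hg, hle, hint⟩
    rw [show -(1 / 64) * n * ε n ^ 2 = -(1 / 64 * (n * ε n ^ 2)) by ring]
    exact (lintegral_mono_ae hle).trans hint
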